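/- **Unconditional level of the post-clustering test, dimension one.** Let $n\in\mathbb N$, $\lambda>0$, and let $X\sim\mathcal N(\mu,\Sigma)$ be a Gaussian vector in $\mathbb R^n$ with invertible covariance matrix $\Sigma$. *Clustering.* For $x\in\mathbb R^n$ let $\widehat B(x)$ be the minimizer over $B\in\mathbb R^n$ of $\frac12\|B-x\|_2^2+\lambda\sum_{i<i'}|B_{i'}-B_i|$. If $b_1>\dots>b_K$ are the distinct values of its coordinates, the clustering of $x$ is $\mathcal C(x)=(\mathcal C_1,\dots,\mathcal C_K)$ with $\mathcal C_k=\{i:\widehat B_i(x)=b_k\}$. For $1\le K\le n$ let $\mathcal T_{K,n}$ be the set of integer vectors $\mathbf t=(t_k)_{0\le k\le K}$ with $0=t_0<t_1<\dots<t_K=n$. For $\mathbf t\in\mathcal T_{K,n}$ and a permutation $\sigma$ of $\{1,\dots,n\}$, put $n_k=t_k-t_{k-1}$ and let $\mathcal C(\mathbf t,\sigma)$ be the clustering with $k$-th cluster $\{\sigma(t_{k-1}+1),\dots,\sigma(t_k)\}$, $1\le k\le K$. Let $S=S(X)$ be a permutation such that $X_{S(1)}\ge\dots\ge X_{S(n)}$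 (almost surely unique), and let $\mathbf T=\mathbf T(X)\in\mathcal T_{K(X),n}$ be the vector such that $\mathcal C(\mathbf T,S)=\mathcal C(X)$. *The $p$-value.* For $\mathbf t\in\mathcal T_{K,n}$ and $\sigma$, write $(\mathbf P_\sigma x)_i=x_{\sigma(i)}$, and let $\mathbf M(\mathbf t)\in\mathbb R^{2(n-1)\times n}$, $\mathbf m(\mathbf t)\in\mathbb R^{2(n-1)}$ be such that $\mathbf M(\mathbf t)y\le\lambda\,\mathbf m(\mathbf t)$ is, row by row, the system $$y_{i+1}-y_i\le 0\quad(1\le i\le n-1),$$ $$\frac1{n_{k+1}}\sum_{i=1}^{n_{k+1}}y_{t_k+i}-\frac1{n_k}\sum_{i=1}^{n_k}y_{t_{k-1}+i}\le-\lambda(t_{k+1}-t_{k-1})\quad(1\le k\le K-1),$$ $$\frac1\ell\sum_{i=1}^{\ell}y_{t_{k-1}+i}-\frac1{n_k}\sum_{i=1}^{n_k}y_{t_{k-1}+i}\le\lambda(n_k-\ell)\quad(1\le k\le K,\ 1\le\ell\le n_k-1).$$ For a nonzero $\eta\in\mathbb R^n$ put $c=\Sigma\eta(\eta^\top\Sigma\eta)^{-1}$,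 $Z(x)=(I_n-c\,\eta^\top)x$, and, with $\mathbf M=\mathbf M(\mathbf t)$, $m=\mathbf m(\mathbf t)$, $$\mathcal V^-(z)=\max_{l:(\mathbf M\mathbf P_\sigma c)_l<0}\frac{\lambda m_l-(\mathbf M\mathbf P_\sigma z)_l}{(\mathbf M\mathbf P_\sigma c)_l},\qquad \mathcal V^+(z)=\min_{l:(\mathbf M\mathbf P_\sigma c)_l>0}\frac{\lambda m_l-(\mathbf M\mathbf P_\sigma z)_l}{(\mathbf M\mathbf P_\sigma c)_l},$$ where an empty maximum is $-\infty$ and an empty minimum is $+\infty$. Let $F_{0,\tau^2}^{[a,b]}$ be the cumulative distribution function of $\mathcal N(0,\tau^2)$ truncated to $[a,b]$. When $\eta$ is attached to the pair $(\mathbf t,\sigma)$, i.e. $\eta=\eta(\mathbf t,\sigma)$, define $$F(x,\mathbf t,\sigma)=F_{0,\;\eta^\top\Sigma\eta}^{[\mathcal V^-(Z(x)),\,\mathcal V^+(Z(x))]}(\eta^\top x),\qquad \mathrm{pval}(x,\mathbf t,\sigma)=2\min\{F(x,\mathbf t,\sigma),\,1-F(x,\mathbf t,\sigma)\},$$ whenever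 $\mathcal V^-(Z(x))<\mathcal V^+(Z(x))$ (on the event below this holds almost surely at $x=X$, $(\mathbf t,\sigma)=(\mathbf T,S)$). *Statement.* Let $\mathcal E$ be any set of pairs $(\mathbf t,\sigma)$ with $\mathbf t\in\bigcup_{1\le K\le n}\mathcal T_{K,n}$ and $\sigma$ a permutation of $\{1,\dots,n\}$, and let $\eta:\mathcal E\to\mathbb R^n\setminus\{0\}$ be a deterministic function. Assume that the event $A=\{(\mathbf T,S)\in\mathcal E,\ \eta(\mathbf T,S)^\top\mu=0\}$ has positive probability. Then, conditionally on $A$, $\mathrm{pval}(X,\mathbf T,S)$ is uniformly distributed on $[0,1]$: $$\mathbb P\bigl(\mathrm{pval}(X,\mathbf T,S)\le t\,\big|\,(\mathbf T,S)\in\mathcal E,\ \eta(\mathbf T,S)^\top\mu=0\bigr)=t\qquad\text{for all }t\in[0,1].$$ -/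

import Mathlib

open MeasureTheory ProbabilityTheory Matrix

noncomputable section

namespace ConvexClustering

/-! Indices are shifted by one throughout: observations, positions and clusters are numbered from 0,
so that the cluster with right-limits `t k < t (k + 1)` occupies the positions `j` with
`t k ≤ j < t (k + 1)`. -/

/-! ### Convex clustering and clusterings -/

/-- The criterion `½ ‖B - x‖² + λ ∑_{i < i'} |B_{i'} - B_i|`. -/
def objective {n : ℕ} (lam : ℝ) (x B : Fin n → ℝ) : ℝ :=
  (1 / 2) * ∑ i, (B i - x i) ^ 2 + lam * ∑ i, ∑ i' ∈ Finset.Ioi i, |B i' - B i|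

/-- The clustering associated with a vector `B`: the list of the sets `{i | B i = b}`, where `b` runs
through the distinct values of `B` in decreasing order. -/
def clusteringOf {n : ℕ} (B : Fin n → ℝ) : List (Finset (Fin n)) :=
  ((Finset.univ.image B).sort (· ≥ ·)).map fun b => Finset.univ.filter fun i => B i = b

/-- Sequences of right-limits `0 = t_0 < t_1 < ⋯ < t_K = n`. -/
abbrev CutVector (K n : ℕ) : Type :=
  {t : Fin (K + 1) → ℕ // StrictMono t ∧ t 0 = 0 ∧ t (Fin.last K) = n}

/-- The pairs `(t, σ)`, with an arbitrary number of clusters. -/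
abbrev CutOrder (n : ℕ) : Type := (Σ K : ℕ, CutVector K n) × Equiv.Perm (Fin n)

/-- `t_k`, for the cluster number `k`: the first position in the cluster. -/
def left {K n : ℕ} (t : CutVector K n) (k : Fin K) : ℕ := t.1 k.castSucc

/-- `t_{k+1}`, for the cluster number `k`: the first position after the cluster. -/
def right {K n : ℕ} (t : CutVector K n) (k : Fin K) : ℕ := t.1 k.succ

/-- The cardinality `t_{k+1} - t_k` of the cluster number `k`. -/
def size {K n : ℕ} (t : CutVector K n) (k : Fin K) : ℕ := right t k - left t k

/-- Position `j` lies in the cluster number `k`. -/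
def InCluster {K n : ℕ} (t : CutVector K n) (k : Fin K) (j : Fin n) : Prop :=
  left t k ≤ (j : ℕ) ∧ (j : ℕ) < right t k

instance {K n : ℕ} (t : CutVector K n) (k : Fin K) (j : Fin n) : Decidable (InCluster t k j) :=
  inferInstanceAs (Decidable (_ ∧ _))

/-- The clustering associated with `(t, σ)`: the `k`-th cluster consists of the `σ j`, for the
positions `j` with `t k ≤ j < t (k + 1)`. -/
def clusteringOfCuts {n : ℕ} (p : CutOrder n) : List (Finset (Fin n)) :=
  List.ofFn fun k : Fin p.1.1 => (Finset.univ.filter (InCluster p.1.2 k)).image p.2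

/-! ### The polyhedral constraints `M(t) P_σ x ≤ λ m(t)` -/

/-- Index set of the rows of `M(t)`: the `n - 1` rows of `M₁`, the `K - 1` rows of `M₂(t)`, and the
`∑ k, (n_k - 1) = n - K` rows of `M₃(t)`. -/
abbrev Row {K n : ℕ} (t : CutVector K n) : Type :=
  Fin (n - 1) ⊕ Fin (K - 1) ⊕ (Σ k : Fin K, Fin (size t k - 1))

/-- The cluster number `k`, for `k < K - 1`. -/
def cur {K : ℕ} (k : Fin (K - 1)) : Fin K := ⟨k, by omega⟩

/-- The cluster number `k + 1`, for `k < K - 1`. -/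
def next {K : ℕ} (k : Fin (K - 1)) : Fin K := ⟨k + 1, by omega⟩

/-- Row `i` of `M₁ y` is `y_{i+1} - y_i`. -/
def M₁ (n : ℕ) : Matrix (Fin (n - 1)) (Fin n) ℝ :=
  Matrix.of fun i j => if (j : ℕ) = i then -1 else if (j : ℕ) = i + 1 then 1 else 0

/-- Row `k` of `M₂(t) y` is the mean of `y` over cluster `k + 1` minus its mean over cluster `k`. -/
def M₂ {K n : ℕ} (t : CutVector K n) : Matrix (Fin (K - 1)) (Fin n) ℝ :=
  Matrix.of fun k j =>
    if InCluster t (cur k) j then -(1 / (size t (cur k) : ℝ))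
    else if InCluster t (next k) j then 1 / (size t (next k) : ℝ) else 0

/-- `m₂(t)_k = -(t_{k+2} - t_k)`. -/
def m₂ {K n : ℕ} (t : CutVector K n) (k : Fin (K - 1)) : ℝ :=
  -((right t (next k) : ℝ) - (left t (cur k) : ℝ))

/-- Row `(k, ℓ)` of `M₃(t) y`, for `ℓ + 1 < n_k`, is the mean of `y` over the first `ℓ + 1` positions
of cluster `k` minus its mean over cluster `k`. -/
def M₃ {K n : ℕ} (t : CutVector K n) :
    Matrix (Σ k : Fin K, Fin (size t k - 1)) (Fin n) ℝ :=
  Matrix.of fun r j =>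
    if InCluster t r.1 j then
      (if (j : ℕ) < left t r.1 + (r.2 + 1) then 1 / ((r.2 : ℝ) + 1) else 0)
        - 1 / (size t r.1 : ℝ)
    else 0

/-- `m₃(t)_{(k, ℓ)} = n_k - (ℓ + 1)`. -/
def m₃ {K n : ℕ} (t : CutVector K n) (r : Σ k : Fin K, Fin (size t k - 1)) : ℝ :=
  (size t r.1 : ℝ) - ((r.2 : ℝ) + 1)

/-- The matrix `M(t)`, with blocks `M₁`, `M₂(t)`, `M₃(t)` on top of each other. -/
def bigM {K n : ℕ} (t : CutVector K n) : Matrix (Row t) (Fin n) ℝ :=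
  Matrix.fromRows (M₁ n) (Matrix.fromRows (M₂ t) (M₃ t))

/-- The vector `m(t)`, with blocks `0`, `m₂(t)`, `m₃(t)`. -/
def smallM {K n : ℕ} (t : CutVector K n) : Row t → ℝ :=
  Sum.elim 0 (Sum.elim (m₂ t) (m₃ t))

/-- `M(t) P_σ`, where `(P_σ x)_i = x_{σ i}`. -/
def constraintMatrix {n : ℕ} (p : CutOrder n) : Matrix (Row p.1.2) (Fin n) ℝ :=
  bigM p.1.2 * p.2.permMatrix ℝ

/-! ### The p-value -/

/-- `c = Σ η (ηᵀ Σ η)⁻¹`. -/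
def direction {n : ℕ} (cov : Matrix (Fin n) (Fin n) ℝ) (v : Fin n → ℝ) : Fin n → ℝ :=
  (v ⬝ᵥ (cov *ᵥ v))⁻¹ • (cov *ᵥ v)

/-- `Z(x) = (I - c ηᵀ) x`. -/
def residual {n : ℕ} (cov : Matrix (Fin n) (Fin n) ℝ) (v x : Fin n → ℝ) : Fin n → ℝ :=
  (1 - Matrix.vecMulVec (direction cov v) v) *ᵥ x

/-- `(λ m_l - (M P_σ z)_l) / (M P_σ c)_l`. -/
def ratio {n : ℕ} (lam : ℝ) (cov : Matrix (Fin n) (Fin n) ℝ) (p : CutOrder n)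
    (v z : Fin n → ℝ) (l : Row p.1.2) : ℝ :=
  (lam * smallM p.1.2 l - (constraintMatrix p *ᵥ z) l) /
    (constraintMatrix p *ᵥ direction cov v) l

/-- `V⁻(z)`: the maximum of the ratios over the rows with `(M P_σ c)_l < 0`, and `-∞` if there are
none. -/
def lowerLimit {n : ℕ} (lam : ℝ) (cov : Matrix (Fin n) (Fin n) ℝ) (p : CutOrder n)
    (v z : Fin n → ℝ) : EReal :=
  (Finset.univ.filter fun l => (constraintMatrix p *ᵥ direction cov v) l < 0).sup
    fun l => (ratio lam cov p v z l : EReal)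

/-- `V⁺(z)`: the minimum of the ratios over the rows with `(M P_σ c)_l > 0`, and `+∞` if there are
none. -/
def upperLimit {n : ℕ} (lam : ℝ) (cov : Matrix (Fin n) (Fin n) ℝ) (p : CutOrder n)
    (v z : Fin n → ℝ) : EReal :=
  (Finset.univ.filter fun l => 0 < (constraintMatrix p *ᵥ direction cov v) l).inf
    fun l => (ratio lam cov p v z l : EReal)

/-- The Gaussian distribution `N(m, τ²)` truncated to the interval `[a, b]`, that is, conditioned to
lie in this interval. -/
def truncatedGaussian (m : ℝ) (τsq : NNReal) (a b : EReal) : Measure ℝ :=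
  (gaussianReal m τsq)[|{y : ℝ | a ≤ (y : EReal) ∧ (y : EReal) ≤ b}]

/-- The invariant statistic `F(ηᵀ x)`, where `F` is the cumulative distribution function of
`N(0, ηᵀ Σ η)` truncated to `[V⁻(Z(x)), V⁺(Z(x))]`. -/
def statistic {n : ℕ} (lam : ℝ) (cov : Matrix (Fin n) (Fin n) ℝ) (v x : Fin n → ℝ)
    (p : CutOrder n) : ℝ :=
  cdf (truncatedGaussian 0 (Real.toNNReal (v ⬝ᵥ (cov *ᵥ v)))
    (lowerLimit lam cov p v (residual cov v x)) (upperLimit lam cov p v (residual cov v x)))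
    (v ⬝ᵥ x)

/-- The two-sided p-value `2 min(F, 1 - F)`, for `F` the invariant statistic. -/
def pval {n : ℕ} (lam : ℝ) (cov : Matrix (Fin n) (Fin n) ℝ) (v x : Fin n → ℝ)
    (p : CutOrder n) : ℝ :=
  2 * min (statistic lam cov v x p) (1 - statistic lam cov v x p)

end ConvexClustering

end

/-! Fix a pair `p = (t, σ)` and put `v = η p`. By `mem_polyhedron_iff`, `X` lies in the polyhedron
of `p` exactly when the residual `Z` lies in a slice and `v ⬝ᵥ X` lies in an interval with endpoints
determined by `Z`. By `indepFun_residual`, `v ⬝ᵥ X` is independent of `Z`, and it is centred when `v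
⬝ᵥ μ = 0`. With `Z` frozen, the p-value is therefore the two-sided probability integral transform of
a truncated Gaussian, hence uniform (`measure_polyhedron_inter_pval_le`). The admissible pairs with
`η p ⬝ᵥ μ = 0` form a deterministic countable set, so these identities sum to the theorem
(`measure_select_le`).

It remains to see that `(T, S) = p` is almost surely the polyhedral event
(`IsGeneric.selection_eq_iff`). After sorting, the fusion penalty is linear on nonincreasing
vectors, and convex clustering becomes isotonic regression of `shifted`: the clusters are delimited
by the vertices of the least concave majorant of its partial sums, and the levels are the slopes.
The rows of `M₂` say that the slopes decrease, and those of `M₃` that the partial sums stay below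
the chords. First-order conditions show that the true selection yields a majorant
(`isMajorant_of_isMinOn`). Conversely, a generic point of the polyhedron of `p` yields one too, and
majorants are unique (`IsMajorant.cut_unique`), so sufficiency of the optimality conditions is never
needed. The exceptional points lie on countably many hyperplanes, which a nondegenerate Gaussian
does not charge. -/

noncomputable section

namespace ConvexClustering

/-! ### The probability integral transform -/

/-- The cumulative distribution function of an atomless probability measure is continuous. -/
lemma continuous_cdf (ν : Measure ℝ) [IsProbabilityMeasure ν] [NullSingletonClass ν] :
    Continuous (cdf ν) := by
  refine continuous_iff_continuousAt.2 fun x => ?_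
  rw [(monotone_cdf ν).continuousAt_iff_leftLim_eq_rightLim, StieltjesFunction.rightLim_eq]
  -- The mass of a point is the jump of the cdf there.
  have h := (cdf ν).measure_singleton x
  rw [measure_cdf, measure_singleton, eq_comm, ENNReal.ofReal_eq_zero] at h
  linarith [(monotone_cdf ν).leftLim_le (le_refl x)]

/-- The sublevel sets of a continuous cumulative distribution function. -/
lemma measure_cdf_le (ν : Measure ℝ) [IsProbabilityMeasure ν] [NullSingletonClass ν] {r : ℝ}
    (h0 : 0 ≤ r) (h1 : r < 1) : ν {y | cdf ν y ≤ r} = ENNReal.ofReal r := by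
  have hc := continuous_cdf ν
  obtain ⟨M, hM⟩ : ∃ M, r < cdf ν M :=
    ((tendsto_cdf_atTop ν).eventually (lt_mem_nhds h1)).exists
  by_cases hne : {y | cdf ν y ≤ r}.Nonempty
  · have hbdd : BddAbove {y | cdf ν y ≤ r} := ⟨M, fun y hy => by
      by_contra! h
      exact absurd (monotone_cdf ν h.le) (not_le.2 (lt_of_le_of_lt hy hM))⟩
    have hmem := (isClosed_le hc continuous_const).csSup_mem hne hbdd
    set y₁ := sSup {y | cdf ν y ≤ r}
    have hset : {y | cdf ν y ≤ r} = Set.Iic y₁ := Set.Subset.antisymm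
      (fun y hy => le_csSup hbdd hy) fun y hy => (monotone_cdf ν hy).trans hmem
    have hle : r ≤ cdf ν y₁ := by
      by_contra! hlt
      obtain ⟨y₀, -, hy₀⟩ := intermediate_value_Icc
        (by by_contra! h; exact absurd (monotone_cdf ν h.le) (not_le.2 (hlt.trans hM)) : y₁ ≤ M)
        hc.continuousOn ⟨hlt.le, hM.le⟩
      have : y₀ ≤ y₁ := le_csSup hbdd hy₀.le
      linarith [monotone_cdf ν this]
    rw [hset, ← ofReal_cdf, le_antisymm hmem hle]
  -- The cdf tends to 0 at `-∞`, so a sublevel set can be empty only at level 0.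
  · have hr : r = 0 := by
      by_contra hr
      obtain ⟨y, hy⟩ := ((tendsto_cdf_atBot ν).eventually
        (gt_mem_nhds (lt_of_le_of_ne h0 (Ne.symm hr)))).exists
      exact hne ⟨y, hy.le⟩
    rw [Set.not_nonempty_iff_eq_empty.1 hne, hr]
    simp

/-- A distribution whose cumulative distribution function is the identity on `[0, 1]` is uniform. -/
lemma eq_restrict_Icc_of_measure_Iic {ν : Measure ℝ} [IsProbabilityMeasure ν]
    (h : ∀ t ∈ Set.Icc (0 : ℝ) 1, ν (Set.Iic t) = ENNReal.ofReal t) :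
    ν = volume.restrict (Set.Icc 0 1) := by
  refine Measure.ext_of_Iic _ _ fun a => ?_
  rw [Measure.restrict_apply measurableSet_Iic]
  rcases lt_or_ge a 0 with ha | ha
  · have h1 : ν (Set.Iic a) = 0 :=
      measure_mono_null (Set.Iic_subset_Iic.2 ha.le) (by simpa using h 0 (by simp))
    have h2 : Set.Iic a ∩ Set.Icc 0 1 = ∅ :=
      Set.eq_empty_of_forall_notMem fun y hy => absurd (hy.2.1.trans hy.1) (not_le.2 ha)
    rw [h1, h2, measure_empty]
  rcases le_total a 1 with hb | hb
  · have h2 : Set.Iic a ∩ Set.Icc 0 1 = Set.Icc 0 a :=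
      Set.ext fun y => ⟨fun hy => ⟨hy.2.1, hy.1⟩, fun hy => ⟨hy.2, hy.1, hy.2.trans hb⟩⟩
    rw [h a ⟨ha, hb⟩, h2]; simp
  · have h1 : ν (Set.Iic a) = 1 := le_antisymm prob_le_one
      ((by simp [h 1 (by simp)] : (1 : ENNReal) ≤ ν (Set.Iic 1)).trans
        (measure_mono (Set.Iic_subset_Iic.2 hb)))
    have h2 : Set.Iic a ∩ Set.Icc 0 1 = Set.Icc 0 1 :=
      Set.inter_eq_right.2 fun y hy => hy.2.trans hb
    rw [h1, h2]; simp

/-- The probability integral transform. -/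
lemma map_cdf (ν : Measure ℝ) [IsProbabilityMeasure ν] [NullSingletonClass ν] :
    ν.map (cdf ν) = volume.restrict (Set.Icc 0 1) := by
  have hm : Measurable (cdf ν) := (continuous_cdf ν).measurable
  have := Measure.isProbabilityMeasure_map (μ := ν) hm.aemeasurable
  refine eq_restrict_Icc_of_measure_Iic fun t ht => ?_
  rw [Measure.map_apply hm measurableSet_Iic]
  rcases ht.2.eq_or_lt with rfl | h1
  · rw [Set.eq_univ_of_forall fun y => show y ∈ cdf ν ⁻¹' Set.Iic 1 from cdf_le_one ν y]
    simp
  · exact measure_cdf_le ν ht.1 h1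

/-- The two-sided p-value of an atomless distribution is uniform. -/
lemma measure_two_sided_le (ν : Measure ℝ) [IsProbabilityMeasure ν] [NullSingletonClass ν] {s : ℝ}
    (hs : s ∈ Set.Icc (0 : ℝ) 1) :
    ν {y | 2 * min (cdf ν y) (1 - cdf ν y) ≤ s} = ENNReal.ofReal s := by
  have hm : Measurable (cdf ν) := (continuous_cdf ν).measurable
  have hset : MeasurableSet {u : ℝ | 2 * min u (1 - u) ≤ s} :=
    measurableSet_le (by fun_prop) (by fun_prop)
  have h := Measure.map_apply (μ := ν) hm hset
  rw [map_cdf, Measure.restrict_apply hset] at h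
  refine h.symm.trans ?_
  obtain ⟨h0, h1⟩ := hs
  -- The set is `[0, s/2] ∪ [1 - s/2, 1]`; its two pieces are disjoint only for `s < 1`.
  rcases h1.eq_or_lt with rfl | h1
  · have : {u : ℝ | 2 * min u (1 - u) ≤ 1} ∩ Set.Icc 0 1 = Set.Icc 0 1 := by
      refine Set.inter_eq_right.2 fun u _ => ?_
      change 2 * min u (1 - u) ≤ 1
      linarith [min_le_left u (1 - u), min_le_right u (1 - u)]
    rw [this]; simp
  · have : {u : ℝ | 2 * min u (1 - u) ≤ s} ∩ Set.Icc 0 1 =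
        Set.Icc 0 (s / 2) ∪ Set.Icc (1 - s / 2) 1 := by
      ext u
      have : 2 * min u (1 - u) ≤ s ↔ u ≤ s / 2 ∨ 1 - s / 2 ≤ u := by
        rw [← le_div_iff₀' two_pos, min_le_iff]
        refine or_congr_right ⟨fun h => ?_, fun h => ?_⟩ <;> linarith
      simp only [Set.mem_inter_iff, Set.mem_ofPred_eq, Set.mem_Icc, Set.mem_union, this]
      constructor
      · rintro ⟨h | h, h', h''⟩
        · exact Or.inl ⟨h', h⟩
        · exact Or.inr ⟨h, h''⟩
      · rintro (⟨h, h'⟩ | ⟨h, h'⟩)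
        · exact ⟨Or.inl h', h, by linarith⟩
        · exact ⟨Or.inr h, by linarith, h'⟩
    rw [this, measure_union _ measurableSet_Icc]
    · rw [Real.volume_Icc, Real.volume_Icc, ← ENNReal.ofReal_add (by linarith) (by linarith)]
      congr 1; ring
    · refine Set.disjoint_left.2 fun u hu hu' => ?_
      linarith [hu.2, hu'.1]

/-! ### Conditioning a real variable to lie in a random interval -/

/-- Reals between two extended bounds. -/
def between (a b : EReal) : Set ℝ := {y : ℝ | a ≤ (y : EReal) ∧ (y : EReal) ≤ b}

lemma measurableSet_between (a b : EReal) : MeasurableSet (between a b) :=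
  (measurableSet_le measurable_const measurable_coe_real_ereal).inter
    (measurableSet_le measurable_coe_real_ereal measurable_const)

variable {𝓩 : Type*} [MeasurableSpace 𝓩]

lemma measurableSet_prod_between {a b : 𝓩 → EReal} (ha : Measurable a) (hb : Measurable b) :
    MeasurableSet {q : 𝓩 × ℝ | q.2 ∈ between (a q.1) (b q.1)} :=
  (measurableSet_le (ha.comp measurable_fst) (measurable_coe_real_ereal.comp measurable_snd)).inter
    (measurableSet_le (measurable_coe_real_ereal.comp measurable_snd) (hb.comp measurable_fst))

/-- The conditional cumulative distribution function is jointly measurable in the bounds of the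
interval and in its argument. -/
lemma measurable_cdf_cond {γ : Measure ℝ} [IsProbabilityMeasure γ] {a b : 𝓩 → EReal}
    (ha : Measurable a) (hb : Measurable b) :
    Measurable fun q : 𝓩 × ℝ => (cdf (γ[|between (a q.1) (b q.1)]) q.2 : ℝ) := by
  have hI := measurableSet_prod_between ha hb
  have h1 : Measurable fun q : 𝓩 × ℝ => γ (between (a q.1) (b q.1)) :=
    (measurable_measure_prodMk_left (ν := γ) hI).comp measurable_fst
  have h2 : Measurable fun q : 𝓩 × ℝ => γ (between (a q.1) (b q.1) ∩ Set.Iic q.2) := by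
    have : MeasurableSet {w : (𝓩 × ℝ) × ℝ | w.2 ∈ between (a w.1.1) (b w.1.1) ∩ Set.Iic w.1.2} :=
      (measurableSet_prod_between (ha.comp measurable_fst) (hb.comp measurable_fst)).inter
        (measurableSet_le measurable_snd (measurable_snd.comp measurable_fst))
    exact measurable_measure_prodMk_left (ν := γ) this
  -- Conditioning on a null interval gives the zero measure, for which the quotient formula is not
  -- available; there the value is a fixed monotone function.
  have key : (fun q : 𝓩 × ℝ => (cdf (γ[|between (a q.1) (b q.1)]) q.2 : ℝ)) = fun q =>
      if γ (between (a q.1) (b q.1)) = 0 then cdf (0 : Measure ℝ) q.2 else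
        ((γ (between (a q.1) (b q.1)))⁻¹ * γ (between (a q.1) (b q.1) ∩ Set.Iic q.2)).toReal := by
    ext q
    split_ifs with h
    · rw [cond_eq_zero_of_meas_eq_zero h]
    · have := cond_isProbabilityMeasure h
      rw [cdf_eq_real, measureReal_def, cond_apply (measurableSet_between _ _)]
  rw [key]
  exact Measurable.ite (h1 (measurableSet_singleton 0))
    ((monotone_cdf _).measurable.comp measurable_snd) (h1.inv.mul h2).ennreal_toReal

/-- The conditional two-sided p-value of `U` given that `U` lies in `[a, b]`. -/
def twoSided (γ : Measure ℝ) (a b : EReal) (u : ℝ) : ℝ :=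
  2 * min (cdf (γ[|between a b]) u) (1 - cdf (γ[|between a b]) u)

lemma measurable_twoSided {γ : Measure ℝ} [IsProbabilityMeasure γ] {a b : 𝓩 → EReal}
    (ha : Measurable a) (hb : Measurable b) :
    Measurable fun q : 𝓩 × ℝ => twoSided γ (a q.1) (b q.1) q.2 :=
  ((measurable_cdf_cond ha hb).min (measurable_const.sub (measurable_cdf_cond ha hb))).const_mul 2

/-- Multiplying out the conditioning gives a form that also holds for null intervals, and so can be
integrated over all values of the bounds. -/
lemma measure_between_inter_twoSided_le {γ : Measure ℝ} [IsProbabilityMeasure γ] [NullSingletonClass γ]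
    (a b : EReal) {s : ℝ} (hs : s ∈ Set.Icc (0 : ℝ) 1) :
    γ (between a b ∩ {u | twoSided γ a b u ≤ s}) = ENNReal.ofReal s * γ (between a b) := by
  by_cases h : γ (between a b) = 0
  · rw [h, mul_zero]
    exact measure_mono_null Set.inter_subset_left h
  · have := cond_isProbabilityMeasure h
    have : NullSingletonClass (γ[|between a b]) := ⟨fun x =>
      cond_absolutelyContinuous (measure_singleton x)⟩
    rw [← measure_two_sided_le (γ[|between a b]) hs, mul_comm, mul_comm (γ _),
      cond_mul_eq_inter (measurableSet_between a b)]
    rfl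

/-- If `U` is independent of `Z`, then, on the event that `U` lies in an interval determined by `Z`,
its conditional two-sided p-value is uniform. -/
lemma measure_twoSided_le_of_indepFun {Ω : Type*} [MeasurableSpace Ω] {P : Measure Ω}
    [IsProbabilityMeasure P] {γ : Measure ℝ} [IsProbabilityMeasure γ] [NullSingletonClass γ]
    {U : Ω → ℝ} {Z : Ω → 𝓩} (hU : AEMeasurable U P) (hZ : AEMeasurable Z P)
    (hγ : P.map U = γ) (hind : IndepFun Z U P) {a b : 𝓩 → EReal}
    (ha : Measurable a) (hb : Measurable b) {G : Set 𝓩} (hG : MeasurableSet G)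
    {s : ℝ} (hs : s ∈ Set.Icc (0 : ℝ) 1) :
    P {ω | Z ω ∈ G ∧ U ω ∈ between (a (Z ω)) (b (Z ω)) ∧
        twoSided γ (a (Z ω)) (b (Z ω)) (U ω) ≤ s} =
      ENNReal.ofReal s * P {ω | Z ω ∈ G ∧ U ω ∈ between (a (Z ω)) (b (Z ω))} := by
  have hprod := (indepFun_iff_map_prod_eq_prod_map_map hZ hU).1 hind
  rw [hγ] at hprod
  have := Measure.isProbabilityMeasure_map hZ
  have hA : MeasurableSet {q : 𝓩 × ℝ | q.1 ∈ G ∧ q.2 ∈ between (a q.1) (b q.1)} :=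
    (measurable_fst hG).inter (measurableSet_prod_between ha hb)
  have hB : MeasurableSet {q : 𝓩 × ℝ | q.1 ∈ G ∧ q.2 ∈ between (a q.1) (b q.1) ∧
      twoSided γ (a q.1) (b q.1) q.2 ≤ s} :=
    (measurable_fst hG).inter ((measurableSet_prod_between ha hb).inter
      (measurableSet_le (measurable_twoSided ha hb) measurable_const))
  have e1 := Measure.map_apply_of_aemeasurable (hZ.prodMk hU) hB
  have e2 := Measure.map_apply_of_aemeasurable (hZ.prodMk hU) hA
  rw [hprod] at e1 e2
  refine e1.symm.trans (Eq.trans ?_ (congrArg (ENNReal.ofReal s * ·) e2))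
  -- By independence the joint law is a product, so Fubini freezes `z` and the bounds become
  -- constants.
  rw [Measure.prod_apply hA, Measure.prod_apply hB,
    ← lintegral_const_mul _ (measurable_measure_prodMk_left hA)]
  refine lintegral_congr fun z => ?_
  by_cases hz : z ∈ G
  · have := measure_between_inter_twoSided_le (γ := γ) (a z) (b z) hs
    simpa [hz] using! this
  · simp [hz]

/-! ### Linear forms of a Gaussian vector -/

section Gaussian

variable {n : ℕ} {Ω : Type*} [MeasurableSpace Ω] {P : Measure Ω}
  {μ : Fin n → ℝ} {cov : Matrix (Fin n) (Fin n) ℝ} {X : Ω → Fin n → ℝ}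

lemma aemeasurable_of_hasLaw
    (hX : HasLaw (fun ω => WithLp.toLp 2 (X ω)) (multivariateGaussian (WithLp.toLp 2 μ) cov) P) :
    AEMeasurable X P :=
  (WithLp.measurable_ofLp 2 (Fin n → ℝ)).comp_aemeasurable hX.aemeasurable

lemma covariance_dotProduct (hcov : cov.PosSemidef)
    (hX : HasLaw (fun ω => WithLp.toLp 2 (X ω)) (multivariateGaussian (WithLp.toLp 2 μ) cov) P)
    (v w : Fin n → ℝ) :
    cov[fun ω => v ⬝ᵥ X ω, fun ω => w ⬝ᵥ X ω; P] = v ⬝ᵥ (cov *ᵥ w) := by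
  have h := covarianceBilin_multivariateGaussian (μ := WithLp.toLp 2 μ) hcov
    (WithLp.toLp 2 v) (WithLp.toLp 2 w)
  rw [covarianceBilin_apply_eq_cov IsGaussian.memLp_two_id, ← hX.map_eq, covariance_map
    (by fun_prop) (by fun_prop) hX.aemeasurable] at h
  simpa [Function.comp_def, EuclideanSpace.inner_eq_star_dotProduct, dotProduct_comm] using! h

lemma integral_dotProduct
    (hX : HasLaw (fun ω => WithLp.toLp 2 (X ω)) (multivariateGaussian (WithLp.toLp 2 μ) cov) P)
    (v : Fin n → ℝ) : ∫ ω, v ⬝ᵥ X ω ∂P = v ⬝ᵥ μ := by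
  have h := (innerSL ℝ (WithLp.toLp 2 v : EuclideanSpace ℝ (Fin n))).integral_comp_comm
    (IsGaussian.integrable_fun_id (μ := multivariateGaussian (WithLp.toLp 2 μ) cov))
  rw [integral_id_multivariateGaussian, ← hX.map_eq, integral_map hX.aemeasurable
    (by fun_prop)] at h
  simpa [EuclideanSpace.inner_eq_star_dotProduct, dotProduct_comm] using! h

/-- A linear form of a Gaussian vector is Gaussian. -/
lemma map_dotProduct_eq_gaussianReal (hcov : cov.PosSemidef)
    (hX : HasLaw (fun ω => WithLp.toLp 2 (X ω)) (multivariateGaussian (WithLp.toLp 2 μ) cov) P)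
    (v : Fin n → ℝ) :
    P.map (fun ω => v ⬝ᵥ X ω) = gaussianReal (v ⬝ᵥ μ) (Real.toNNReal (v ⬝ᵥ (cov *ᵥ v))) := by
  have hg : HasGaussianLaw (fun ω => v ⬝ᵥ X ω) P := by
    have := hX.hasGaussianLaw.map_fun (innerSL ℝ (WithLp.toLp 2 v : EuclideanSpace ℝ (Fin n)))
    simpa [EuclideanSpace.inner_eq_star_dotProduct, dotProduct_comm] using! this
  rw [hg.map_eq_gaussianReal, integral_dotProduct hX, ← covariance_self hg.aemeasurable,
    covariance_dotProduct hcov hX]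

lemma dotProduct_mulVec_pos (hcov : cov.PosSemidef) (hinv : IsUnit cov) {v : Fin n → ℝ}
    (hv : v ≠ 0) : 0 < v ⬝ᵥ (cov *ᵥ v) := by
  simpa using (hcov.posDef_iff_isUnit.2 hinv).dotProduct_mulVec_pos hv

/-- A nondegenerate Gaussian vector does not charge affine hyperplanes. -/
lemma measure_dotProduct_eq_zero (hcov : cov.PosSemidef) (hinv : IsUnit cov)
    (hX : HasLaw (fun ω => WithLp.toLp 2 (X ω)) (multivariateGaussian (WithLp.toLp 2 μ) cov) P)
    {v : Fin n → ℝ} (hv : v ≠ 0) (r : ℝ) : P {ω | v ⬝ᵥ X ω = r} = 0 := by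
  have hm : AEMeasurable (fun ω => v ⬝ᵥ X ω) P :=
    Measurable.comp_aemeasurable (g := fun x : Fin n → ℝ => v ⬝ᵥ x) (by fun_prop)
      (aemeasurable_of_hasLaw hX)
  have h := Measure.map_apply_of_aemeasurable hm (measurableSet_singleton r)
  have : NullSingletonClass
      (gaussianReal (v ⬝ᵥ μ) (Real.toNNReal (v ⬝ᵥ (cov *ᵥ v)))) :=
    nullSingletonClass_gaussianReal (by simpa using dotProduct_mulVec_pos hcov hinv hv)
  rw [map_dotProduct_eq_gaussianReal hcov hX, measure_singleton] at h
  exact h.symm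

lemma residual_apply (v x : Fin n → ℝ) (j : Fin n) :
    residual cov v x j = x j - direction cov v j * (v ⬝ᵥ x) := by
  simp [residual, sub_mulVec, vecMulVec_mulVec, mul_comm]

lemma smul_direction_add_residual (v x : Fin n → ℝ) :
    (v ⬝ᵥ x) • direction cov v + residual cov v x = x := by
  ext j
  simp [residual_apply, mul_comm]

lemma measurable_residual (v : Fin n → ℝ) : Measurable (residual cov v) := by
  refine measurable_pi_lambda _ fun j => ?_
  simp only [residual_apply]
  fun_prop

/-- The linear form is independent of the residual. -/
lemma indepFun_residual (hcov : cov.PosSemidef) (hinv : IsUnit cov)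
    (hX : HasLaw (fun ω => WithLp.toLp 2 (X ω)) (multivariateGaussian (WithLp.toLp 2 μ) cov) P)
    {v : Fin n → ℝ} (hv : v ≠ 0) :
    IndepFun (fun ω => residual cov v (X ω)) (fun ω => v ⬝ᵥ X ω) P := by
  -- A single linear image makes the pair jointly Gaussian; the linear form becomes a family over
  -- `Unit` to fit the coordinatewise covariance criterion.
  let L : EuclideanSpace ℝ (Fin n) →L[ℝ] (Fin n → ℝ) × (Unit → ℝ) :=
    LinearMap.toContinuousLinearMap
      { toFun := fun x => (residual cov v x.ofLp, fun _ => v ⬝ᵥ x.ofLp)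
        map_add' := fun x y => by
          ext <;> simp [residual, mulVec_add, dotProduct_add]
        map_smul' := fun r x => by
          ext <;> simp [residual, mulVec_smul, dotProduct_smul] }
  have hg : HasGaussianLaw (fun ω => ((fun j => residual cov v (X ω) j),
      fun _ : Unit => v ⬝ᵥ X ω)) P := hX.hasGaussianLaw.map_fun L
  have hind := hg.indepFun_of_covariance_eval (X := fun j ω => residual cov v (X ω) j)
    (Y := fun _ ω => v ⬝ᵥ X ω) fun j _ => ?_
  · exact hind.comp (φ := id) (ψ := fun f : Unit → ℝ => f ()) measurable_id (by fun_prop)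
  · have hpos := dotProduct_mulVec_pos hcov hinv hv
    have hrow : (fun ω => residual cov v (X ω) j) =
        fun ω => (Pi.single j 1 - direction cov v j • v) ⬝ᵥ X ω := by
      ext ω; simp [residual_apply, sub_dotProduct]
    -- The covariance is `(Σv)_j - c_j (vᵀΣv)`, which vanishes by the choice of `c`.
    rw [hrow, covariance_dotProduct hcov hX]
    simp [sub_dotProduct, direction]
    field_simp
    simp

end Gaussian

/-! ### The selection polyhedra -/

section Polyhedron

variable {n : ℕ} {lam : ℝ} {cov : Matrix (Fin n) (Fin n) ℝ}

/-- The polyhedron `M(t) P_σ x ≤ λ m(t)`. -/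
def polyhedron (lam : ℝ) (p : CutOrder n) : Set (Fin n → ℝ) :=
  {x | ∀ l, (constraintMatrix p *ᵥ x) l ≤ lam * smallM p.1.2 l}

/-- The residuals that satisfy the constraints which do not involve the linear form. -/
def residualSlice (lam : ℝ) (cov : Matrix (Fin n) (Fin n) ℝ) (p : CutOrder n) (v : Fin n → ℝ) :
    Set (Fin n → ℝ) :=
  {z | ∀ l, (constraintMatrix p *ᵥ direction cov v) l = 0 →
    (constraintMatrix p *ᵥ z) l ≤ lam * smallM p.1.2 l}

lemma measurable_mulVec_apply {m : Type*} (A : Matrix m (Fin n) ℝ) (l : m) :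
    Measurable fun x : Fin n → ℝ => (A *ᵥ x) l := by
  change Measurable fun x : Fin n → ℝ => A l ⬝ᵥ x
  fun_prop

lemma measurableSet_polyhedron (p : CutOrder n) : MeasurableSet (polyhedron lam p) := by
  simp only [polyhedron, Set.ofPred_forall]
  exact MeasurableSet.iInter fun l =>
    measurableSet_le (measurable_mulVec_apply _ l) measurable_const

lemma measurableSet_residualSlice (p : CutOrder n) (v : Fin n → ℝ) :
    MeasurableSet (residualSlice lam cov p v) := by
  simp only [residualSlice, Set.ofPred_forall]
  exact MeasurableSet.iInter fun l => MeasurableSet.iInter fun _ =>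
    measurableSet_le (measurable_mulVec_apply _ l) measurable_const

lemma measurable_ratio (p : CutOrder n) (v : Fin n → ℝ) (l : Row p.1.2) :
    Measurable fun z => (ratio lam cov p v z l : EReal) :=
  measurable_coe_real_ereal.comp
    ((measurable_const.sub (measurable_mulVec_apply _ l)).div_const _)

lemma measurable_lowerLimit (p : CutOrder n) (v : Fin n → ℝ) :
    Measurable (lowerLimit lam cov p v) := by
  simp only [funext_iff.2 fun z => show lowerLimit lam cov p v z = _ from Finset.sup_eq_iSup _ _]
  exact Measurable.iSup fun l => Measurable.iSup fun _ => measurable_ratio p v l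

lemma measurable_upperLimit (p : CutOrder n) (v : Fin n → ℝ) :
    Measurable (upperLimit lam cov p v) := by
  simp only [funext_iff.2 fun z => show upperLimit lam cov p v z = _ from Finset.inf_eq_iInf _ _]
  exact Measurable.iInf fun l => Measurable.iInf fun _ => measurable_ratio p v l

/-- The polyhedral lemma: the selection event is the event that the linear form lies between the
two truncation limits. -/
lemma mem_polyhedron_iff (p : CutOrder n) (v x : Fin n → ℝ) :
    x ∈ polyhedron lam p ↔ residual cov v x ∈ residualSlice lam cov p v ∧
      v ⬝ᵥ x ∈ between (lowerLimit lam cov p v (residual cov v x))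
        (upperLimit lam cov p v (residual cov v x)) := by
  set z := residual cov v x with hz
  -- For fixed `z`, each constraint is affine in `v ⬝ᵥ x`; the sign of its slope decides whether it
  -- bounds from below, from above, or only restricts `z`.
  have hx : ∀ l, (constraintMatrix p *ᵥ x) l =
      (v ⬝ᵥ x) * (constraintMatrix p *ᵥ direction cov v) l + (constraintMatrix p *ᵥ z) l := by
    intro l
    conv_lhs => rw [← smul_direction_add_residual (cov := cov) v x, mulVec_add, mulVec_smul]
    rfl
  simp only [polyhedron, residualSlice, between, lowerLimit, upperLimit, Finset.sup_le_iff,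
    Finset.le_inf_iff, Set.mem_ofPred_eq, Finset.mem_filter, Finset.mem_univ, true_and,
    EReal.coe_le_coe_iff, hx, ratio]
  constructor
  · refine fun h => ⟨fun l hl => ?_, fun l hl => ?_, fun l hl => ?_⟩
    · simpa [hl] using h l
    · rw [div_le_iff_of_neg hl]; linarith [h l]
    · rw [le_div_iff₀ hl]; linarith [h l]
  · rintro ⟨h0, h1, h2⟩ l
    rcases lt_trichotomy ((constraintMatrix p *ᵥ direction cov v) l) 0 with hl | hl | hl
    · have := h1 l hl
      rw [div_le_iff_of_neg hl] at this; linarith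
    · simpa [hl] using h0 l hl
    · have := h2 l hl
      rw [le_div_iff₀ hl] at this; linarith

lemma pval_eq_twoSided (v x : Fin n → ℝ) (p : CutOrder n) :
    pval lam cov v x p = twoSided (gaussianReal 0 (Real.toNNReal (v ⬝ᵥ (cov *ᵥ v))))
      (lowerLimit lam cov p v (residual cov v x)) (upperLimit lam cov p v (residual cov v x))
      (v ⬝ᵥ x) := rfl

lemma measurable_pval (v : Fin n → ℝ) (p : CutOrder n) :
    Measurable fun x => pval lam cov v x p := by
  have h1 : Measurable fun x : Fin n → ℝ => (residual cov v x, v ⬝ᵥ x) :=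
    (measurable_residual v).prodMk (by fun_prop)
  have h2 := (measurable_twoSided (γ := gaussianReal 0 (Real.toNNReal (v ⬝ᵥ (cov *ᵥ v))))
    (measurable_lowerLimit (lam := lam) (cov := cov) p v)
    (measurable_upperLimit (lam := lam) (cov := cov) p v)).comp h1
  simpa only [pval_eq_twoSided, Function.comp_def] using h2

/-- On the event that `X` lies in the polyhedron of `p`, the p-value attached to `p` is uniform. -/
lemma measure_polyhedron_inter_pval_le {Ω : Type*} [MeasurableSpace Ω] {P : Measure Ω}
    [IsProbabilityMeasure P] {μ : Fin n → ℝ} {X : Ω → Fin n → ℝ}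
    (hcov : cov.PosSemidef) (hinv : IsUnit cov)
    (hX : HasLaw (fun ω => WithLp.toLp 2 (X ω)) (multivariateGaussian (WithLp.toLp 2 μ) cov) P)
    (p : CutOrder n) {v : Fin n → ℝ} (hv : v ≠ 0) (hvμ : v ⬝ᵥ μ = 0)
    {s : ℝ} (hs : s ∈ Set.Icc (0 : ℝ) 1) :
    P {ω | X ω ∈ polyhedron lam p ∧ pval lam cov v (X ω) p ≤ s} =
      ENNReal.ofReal s * P {ω | X ω ∈ polyhedron lam p} := by
  have hXm := aemeasurable_of_hasLaw hX
  have : NullSingletonClass (gaussianReal 0 (Real.toNNReal (v ⬝ᵥ (cov *ᵥ v)))) :=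
    nullSingletonClass_gaussianReal (by simpa using dotProduct_mulVec_pos hcov hinv hv)
  have h := measure_twoSided_le_of_indepFun
    (Measurable.comp_aemeasurable (g := fun x : Fin n → ℝ => v ⬝ᵥ x) (by fun_prop) hXm)
    ((measurable_residual v).comp_aemeasurable hXm)
    -- The null hypothesis enters here: it makes the true law the centred one used by the p-value.
    ((map_dotProduct_eq_gaussianReal hcov hX v).trans (by rw [hvμ]))
    (indepFun_residual hcov hinv hX hv) (measurable_lowerLimit (lam := lam) (cov := cov) p v)
    (measurable_upperLimit (lam := lam) (cov := cov) p v)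
    (measurableSet_residualSlice (lam := lam) (cov := cov) p v) hs
  simpa only [mem_polyhedron_iff (cov := cov) p v, pval_eq_twoSided, and_assoc] using! h

end Polyhedron

/-! ### Cut vectors -/

section Cuts

variable {K n : ℕ}

lemma left_lt_right (t : CutVector K n) (k : Fin K) : left t k < right t k :=
  t.2.1 k.castSucc_lt_succ

lemma right_le (t : CutVector K n) (k : Fin K) : right t k ≤ n :=
  (t.2.1.monotone (Fin.le_last _)).trans_eq t.2.2.2

lemma right_le_left (t : CutVector K n) {k k' : Fin K} (h : k < k') : right t k ≤ left t k' :=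
  t.2.1.monotone (Fin.succ_le_castSucc_iff.2 h)

lemma size_cast (t : CutVector K n) (k : Fin K) :
    (size t k : ℝ) = (right t k : ℝ) - (left t k : ℝ) :=
  Nat.cast_sub (left_lt_right t k).le

lemma size_cast_pos (t : CutVector K n) (k : Fin K) : (0 : ℝ) < size t k := by
  exact_mod_cast Nat.sub_pos_of_lt (left_lt_right t k)

lemma cluster_unique (t : CutVector K n) {k k' : Fin K} {j : ℕ} (h1 : left t k ≤ j)
    (h2 : j < right t k) (h3 : left t k' ≤ j) (h4 : j < right t k') : k = k' := by
  rcases lt_trichotomy k k' with h | h | h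
  · have := right_le_left t h; omega
  · exact h
  · have := right_le_left t h; omega

lemma exists_cluster (t : CutVector K n) {j : ℕ} (hj : j < n) :
    ∃ k, left t k ≤ j ∧ j < right t k := by
  have key : ∀ i : Fin (K + 1), j < t.1 i → ∃ k, left t k ≤ j ∧ j < right t k := by
    intro i
    induction i using Fin.induction with
    | zero => intro h; rw [t.2.2.1] at h; omega
    | succ i ih =>
      intro h
      by_cases h' : j < t.1 i.castSucc
      · exact ih h'
      · exact ⟨i, not_lt.1 h', h⟩
  exact key (Fin.last K) (by rw [t.2.2.2]; exact hj)

/-- The sequence equal to `b k` on the cluster number `k`. -/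
def step (t : CutVector K n) (b : Fin K → ℝ) (j : ℕ) : ℝ :=
  ∑ k, if left t k ≤ j ∧ j < right t k then b k else 0

lemma step_eq (t : CutVector K n) (b : Fin K → ℝ) {k : Fin K} {j : ℕ} (h1 : left t k ≤ j)
    (h2 : j < right t k) : step t b j = b k := by
  rw [step, Finset.sum_eq_single k]
  · rw [if_pos ⟨h1, h2⟩]
  · intro k' _ hk'
    rw [if_neg]
    rintro ⟨h3, h4⟩
    exact hk' (cluster_unique t h3 h4 h1 h2)
  · simp

lemma step_antitone (t : CutVector K n) {b : Fin K → ℝ} (hb : StrictAnti b) {i j : ℕ}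
    (hij : i ≤ j) (hj : j < n) : step t b j ≤ step t b i := by
  obtain ⟨k, h1, h2⟩ := exists_cluster t hj
  obtain ⟨k', h3, h4⟩ := exists_cluster t (hij.trans_lt hj)
  rw [step_eq t b h1 h2, step_eq t b h3 h4]
  refine hb.antitone (not_lt.1 fun h => ?_)
  have := right_le_left t h; omega

lemma sum_step (t : CutVector K n) (b : Fin K → ℝ) (k : Fin K) {a c : ℕ} (ha : left t k ≤ a)
    (hac : a ≤ c) (hc : c ≤ right t k) :
    ∑ j ∈ Finset.Ico a c, step t b j = ((c : ℝ) - a) * b k := by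
  rw [Finset.sum_congr rfl fun j hj => step_eq t b (ha.trans (Finset.mem_Ico.1 hj).1)
    ((Finset.mem_Ico.1 hj).2.trans_le hc)]
  simp [Nat.cast_sub hac]

/-! ### Vertices of the least concave majorant of the partial sums -/

/-- The cuts `t` are the vertices, and `b` the slopes, of the least concave majorant of the
sequence of partial sums of `f`. -/
structure IsMajorant (f : ℕ → ℝ) (t : CutVector K n) (b : Fin K → ℝ) : Prop where
  strictAnti : StrictAnti b
  sum_eq : ∀ k, ∑ j ∈ Finset.Ico (left t k) (right t k), f j = size t k * b k
  sum_le : ∀ k m, left t k ≤ m → m ≤ right t k →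
    ∑ j ∈ Finset.Ico (left t k) m, f j ≤ ((m : ℝ) - left t k) * b k

namespace IsMajorant

variable {f : ℕ → ℝ} {t : CutVector K n} {b : Fin K → ℝ}

/-- The majorant touches the partial sums at its vertices, because the sums agree cluster by
cluster. -/
lemma sum_range_cut (h : IsMajorant f t b) (i : Fin (K + 1)) :
    ∑ j ∈ Finset.range (t.1 i), step t b j = ∑ j ∈ Finset.range (t.1 i), f j := by
  induction i using Fin.induction with
  | zero => simp [t.2.2.1]
  | succ k ih =>
    have hlt : t.1 k.castSucc ≤ t.1 k.succ := (left_lt_right t k).le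
    rw [← Finset.sum_range_add_sum_Ico _ hlt, ← Finset.sum_range_add_sum_Ico _ hlt, ih]
    congr 1
    have e := sum_step t b k le_rfl (left_lt_right t k).le le_rfl
    rw [← size_cast t k] at e
    exact e.trans (h.sum_eq k).symm

lemma sum_range_le (h : IsMajorant f t b) {m : ℕ} (hm : m ≤ n) :
    ∑ j ∈ Finset.range m, f j ≤ ∑ j ∈ Finset.range m, step t b j := by
  rcases hm.eq_or_lt with rfl | hm
  · have := h.sum_range_cut (Fin.last K)
    rw [t.2.2.2] at this
    exact this.ge
  · obtain ⟨k, h1, h2⟩ := exists_cluster t hm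
    have := h.sum_range_cut k.castSucc
    rw [← Finset.sum_range_add_sum_Ico _ h1, ← Finset.sum_range_add_sum_Ico _ h1,
      sum_step t b k le_rfl h1 h2.le]
    exact add_le_add this.ge (h.sum_le k m h1 h2.le)

variable {K' : ℕ} {t' : CutVector K' n} {b' : Fin K' → ℝ}

/-- Minimality: the second majorant is affine between its vertices and equals the partial sums
there, hence lies below the first one at the ends of each piece; concavity of the first propagates
this inside. -/
lemma sum_step_le (h : IsMajorant f t b) (h' : IsMajorant f t' b') {m : ℕ} (hm : m ≤ n) :
    ∑ j ∈ Finset.range m, step t' b' j ≤ ∑ j ∈ Finset.range m, step t b j := by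
  rcases hm.eq_or_lt with rfl | hm
  · have := h'.sum_range_cut (Fin.last K')
    rw [t'.2.2.2] at this
    exact this.le.trans (h.sum_range_le le_rfl)
  · obtain ⟨k, h1, h2⟩ := exists_cluster t' hm
    have ha := (h'.sum_range_cut k.castSucc).le.trans
      (h.sum_range_le ((h1.trans h2.le).trans (right_le t' k)))
    have hc := (h'.sum_range_cut k.succ).le.trans (h.sum_range_le (right_le t' k))
    change ∑ j ∈ Finset.range (left t' k), _ ≤ ∑ j ∈ Finset.range (left t' k), _ at ha
    change ∑ j ∈ Finset.range (right t' k), _ ≤ ∑ j ∈ Finset.range (right t' k), _ at hc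
    have e1 := sum_step t' b' k le_rfl h1 h2.le
    have e2 := sum_step t' b' k h1 h2.le le_rfl
    have i1 : ((m : ℝ) - left t' k) * step t b m ≤
        ∑ j ∈ Finset.Ico (left t' k) m, step t b j := by
      have := Finset.card_nsmul_le_sum (Finset.Ico (left t' k) m) (step t b) (step t b m)
        fun j hj => step_antitone t h.strictAnti (Finset.mem_Ico.1 hj).2.le hm
      simpa [Nat.cast_sub h1] using this
    have i2 : ∑ j ∈ Finset.Ico m (right t' k), step t b j ≤
        ((right t' k : ℝ) - m) * step t b m := by
      have := Finset.sum_le_card_nsmul (Finset.Ico m (right t' k)) (step t b) (step t b m)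
        fun j hj => step_antitone t h.strictAnti (Finset.mem_Ico.1 hj).1
          ((Finset.mem_Ico.1 hj).2.trans_le (right_le t' k))
      simpa [Nat.cast_sub h2.le] using this
    have s1 := Finset.sum_range_add_sum_Ico (step t b) h1
    have s2 := Finset.sum_range_add_sum_Ico (step t b) h2.le
    have s3 := Finset.sum_range_add_sum_Ico (step t' b') h1
    have s4 := Finset.sum_range_add_sum_Ico (step t' b') h2.le
    have p1 : (0 : ℝ) ≤ (m : ℝ) - left t' k := sub_nonneg.2 (Nat.cast_le.2 h1)
    have p2 : (0 : ℝ) ≤ (right t' k : ℝ) - m := sub_nonneg.2 (Nat.cast_le.2 h2.le)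
    -- Compare from the left end if the chord is flatter than the concave function at `m`, from the
    -- right end if it is steeper.
    rcases le_total (b' k) (step t b m) with hle | hle
    · have := mul_le_mul_of_nonneg_left hle p1
      linarith
    · have := mul_le_mul_of_nonneg_left hle p2
      linarith

lemma step_unique (h : IsMajorant f t b) (h' : IsMajorant f t' b') {j : ℕ} (hj : j < n) :
    step t b j = step t' b' j := by
  have key : ∀ m ≤ n, ∑ j ∈ Finset.range m, step t b j = ∑ j ∈ Finset.range m, step t' b' j :=
    fun m hm => le_antisymm (h'.sum_step_le h hm) (h.sum_step_le h' hm)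
  have h1 := key (j + 1) hj
  rw [Finset.sum_range_succ, Finset.sum_range_succ, key j hj.le] at h1
  exact add_left_cancel h1

/-- Distinct slopes make every interior cut a jump of `step`, so the step function determines the
cuts. At `m = 0`, where `m - 1 = 0`, the first alternative applies. -/
lemma mem_range_iff (h : StrictAnti b) {m : ℕ} :
    m ∈ Set.range t.1 ↔ m = 0 ∨ m = n ∨ (m < n ∧ step t b m ≠ step t b (m - 1)) := by
  constructor
  · rintro ⟨i, rfl⟩
    by_cases h0 : i = 0
    · left; rw [h0, t.2.2.1]
    by_cases hn : i = Fin.last K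
    · right; left; rw [hn, t.2.2.2]
    right; right
    obtain ⟨k, rfl⟩ := Fin.exists_castSucc_eq.2 hn
    obtain ⟨k', hk'⟩ := Fin.exists_succ_eq.2 h0
    have hlt : t.1 k.castSucc < n := (left_lt_right t k).trans_le (right_le t k)
    have hr : right t k' = t.1 k.castSucc := by rw [right, hk']
    have hl := left_lt_right t k'
    have e1 : step t b (t.1 k.castSucc) = b k := step_eq t b le_rfl (left_lt_right t k)
    have e2 : step t b (t.1 k.castSucc - 1) = b k' :=
      step_eq t b (by omega) (by omega)
    refine ⟨hlt, ?_⟩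
    rw [e1, e2]
    refine h.injective.ne ?_
    rintro rfl
    have := left_lt_right t k
    rw [hr] at this
    exact lt_irrefl _ this
  · rintro (rfl | rfl | ⟨hm, hne⟩)
    · exact ⟨0, t.2.2.1⟩
    · exact ⟨Fin.last K, t.2.2.2⟩
    · obtain ⟨k, h1, h2⟩ := exists_cluster t hm
      refine ⟨k.castSucc, ?_⟩
      change left t k = m
      by_contra hc
      exact hne (by rw [step_eq t b h1 h2, step_eq t b (k := k) (by omega) (by omega)])

/-- The vertices of the least concave majorant are unique. -/
lemma cut_unique (h : IsMajorant f t b) (h' : IsMajorant f t' b') :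
    (⟨K, t⟩ : Σ K, CutVector K n) = ⟨K', t'⟩ := by
  have hr : Set.range t.1 = Set.range t'.1 := by
    ext m
    rw [mem_range_iff h.strictAnti, mem_range_iff h'.strictAnti]
    refine or_congr_right (or_congr_right (and_congr_right fun hm => ?_))
    rw [h.step_unique h' hm, h.step_unique h' (by omega : m - 1 < n)]
  have hK : K = K' := by
    have := congrArg Set.ncard hr
    rw [← Set.image_univ, ← Set.image_univ, Set.ncard_image_of_injective _ t.2.1.injective,
      Set.ncard_image_of_injective _ t'.2.1.injective] at this
    simpa using this
  subst hK
  have : t = t' := Subtype.ext ((t.2.1.range_inj t'.2.1).1 hr)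
  rw [this]

end IsMajorant

end Cuts

/-! ### The polyhedra in terms of least concave majorants -/

section Rows

variable {K n : ℕ}

/-- Extension of a vector by zero. -/
def extend (y : Fin n → ℝ) (j : ℕ) : ℝ := if h : j < n then y ⟨j, h⟩ else 0

lemma extend_coe (y : Fin n → ℝ) (j : Fin n) : extend y j = y j := by simp [extend]

/-- The extension by zero of `y`, corrected by the slope of the fusion penalty. -/
def shifted (lam : ℝ) (y : Fin n → ℝ) (j : ℕ) : ℝ :=
  extend y j + lam * (2 * (j : ℝ) + 1 - n)

lemma sum_Ico_eq (f : ℕ → ℝ) {a c : ℕ} (hc : c ≤ n) :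
    ∑ j : Fin n, (if a ≤ (j : ℕ) ∧ (j : ℕ) < c then f j else 0) = ∑ j ∈ Finset.Ico a c, f j := by
  rw [Fin.sum_univ_eq_sum_range (fun j => if a ≤ j ∧ j < c then f j else 0) n,
    ← Finset.sum_filter]
  congr 1
  ext j
  simp only [Finset.mem_filter, Finset.mem_range, Finset.mem_Ico]
  omega

/-- Since `2j + 1 = (j+1)² - j²`, the correction telescopes to `(c² - a²) - n(c - a)`. This is the
source of the constants in `m₂` and `m₃`. -/
lemma sum_shifted (lam : ℝ) (y : Fin n → ℝ) {a c : ℕ} (hac : a ≤ c) :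
    ∑ j ∈ Finset.Ico a c, shifted lam y j =
      ∑ j ∈ Finset.Ico a c, extend y j + lam * (((c : ℝ) - a) * ((a : ℝ) + c - n)) := by
  induction c, hac using Nat.le_induction with
  | base => simp
  | succ c hc ih =>
    rw [Finset.sum_Ico_succ_top hc, Finset.sum_Ico_succ_top hc, ih, shifted]
    push_cast
    ring

lemma M₁_mulVec (y : Fin n → ℝ) (i : Fin (n - 1)) :
    (M₁ n *ᵥ y) i = y ⟨i + 1, by omega⟩ - y ⟨i, by omega⟩ := by
  have h : ∀ j : Fin n, M₁ n i j * y j =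
      (if j = ⟨i + 1, by omega⟩ then y j else 0) - (if j = ⟨i, by omega⟩ then y j else 0) := by
    intro j
    simp only [M₁, Matrix.of_apply, Fin.ext_iff]
    split_ifs <;> first | omega | simp
  simp only [mulVec, dotProduct, h, Finset.sum_sub_distrib]
  simp

lemma M₂_mulVec (t : CutVector K n) (y : Fin n → ℝ) (k : Fin (K - 1)) :
    (M₂ t *ᵥ y) k =
      (∑ j ∈ Finset.Ico (left t (next k)) (right t (next k)), extend y j) / size t (next k) -
        (∑ j ∈ Finset.Ico (left t (cur k)) (right t (cur k)), extend y j) / size t (cur k) := by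
  have h : ∀ j : Fin n, M₂ t k j * y j =
      (if left t (next k) ≤ (j : ℕ) ∧ (j : ℕ) < right t (next k) then
        extend y j / size t (next k) else 0) -
      (if left t (cur k) ≤ (j : ℕ) ∧ (j : ℕ) < right t (cur k) then
        extend y j / size t (cur k) else 0) := by
    intro j
    have hd : right t (cur k) ≤ left t (next k) :=
      right_le_left t (by simp [cur, next, Fin.lt_def])
    by_cases h1 : left t (cur k) ≤ (j : ℕ) ∧ (j : ℕ) < right t (cur k)
    · have h2 : ¬ (left t (next k) ≤ (j : ℕ) ∧ (j : ℕ) < right t (next k)) := by omega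
      simp [M₂, InCluster, extend_coe, h1, h2, div_eq_inv_mul]
    · by_cases h2 : left t (next k) ≤ (j : ℕ) ∧ (j : ℕ) < right t (next k) <;>
        simp [M₂, InCluster, extend_coe, h1, h2, div_eq_inv_mul]
  simp only [mulVec, dotProduct, h, Finset.sum_sub_distrib]
  rw [sum_Ico_eq (fun j => extend y j / size t (next k)) (right_le t _),
    sum_Ico_eq (fun j => extend y j / size t (cur k)) (right_le t _), Finset.sum_div,
    Finset.sum_div]

lemma M₃_mulVec (t : CutVector K n) (y : Fin n → ℝ) (r : Σ k : Fin K, Fin (size t k - 1)) :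
    (M₃ t *ᵥ y) r =
      (∑ j ∈ Finset.Ico (left t r.1) (left t r.1 + (r.2 + 1)), extend y j) / ((r.2 : ℝ) + 1) -
        (∑ j ∈ Finset.Ico (left t r.1) (right t r.1), extend y j) / size t r.1 := by
  have hlt : left t r.1 + (r.2 + 1) < right t r.1 := by
    have := r.2.2; unfold size at this; omega
  have h : ∀ j : Fin n, M₃ t r j * y j =
      (if left t r.1 ≤ (j : ℕ) ∧ (j : ℕ) < left t r.1 + (r.2 + 1) then
        extend y j / ((r.2 : ℝ) + 1) else 0) -
      (if left t r.1 ≤ (j : ℕ) ∧ (j : ℕ) < right t r.1 then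
        extend y j / size t r.1 else 0) := by
    intro j
    by_cases h1 : left t r.1 ≤ (j : ℕ) ∧ (j : ℕ) < right t r.1
    · by_cases h2 : (j : ℕ) < left t r.1 + (r.2 + 1) <;>
        simp [M₃, InCluster, extend_coe, h1, h2, div_eq_inv_mul, sub_mul]
    · have h2 : ¬ (left t r.1 ≤ (j : ℕ) ∧ (j : ℕ) < left t r.1 + (r.2 + 1)) := by omega
      rw [if_neg h1, if_neg h2]
      simp [M₃, InCluster, h1]
  simp only [mulVec, dotProduct, h, Finset.sum_sub_distrib]
  rw [sum_Ico_eq (fun j => extend y j / ((r.2 : ℝ) + 1)) (hlt.le.trans (right_le t _)),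
    sum_Ico_eq (fun j => extend y j / size t r.1) (right_le t _), Finset.sum_div,
    Finset.sum_div]

lemma constraintMatrix_mulVec (p : CutOrder n) (x : Fin n → ℝ) :
    constraintMatrix p *ᵥ x = bigM p.1.2 *ᵥ (x ∘ p.2) := by
  rw [constraintMatrix, ← mulVec_mulVec, permMatrix_mulVec]

lemma mem_polyhedron_iff_blocks {lam : ℝ} (p : CutOrder n) (x : Fin n → ℝ) :
    x ∈ polyhedron lam p ↔
      (∀ i, (M₁ n *ᵥ (x ∘ p.2)) i ≤ 0) ∧ (∀ k, (M₂ p.1.2 *ᵥ (x ∘ p.2)) k ≤ lam * m₂ p.1.2 k) ∧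
        ∀ r, (M₃ p.1.2 *ᵥ (x ∘ p.2)) r ≤ lam * m₃ p.1.2 r := by
  simp only [polyhedron, Set.mem_ofPred_eq, constraintMatrix_mulVec, bigM, fromRows_mulVec,
    smallM, Sum.forall, Sum.elim_inl, Sum.elim_inr, Pi.zero_apply, mul_zero]

lemma antitone_iff_M₁ (y : Fin n → ℝ) : Antitone y ↔ ∀ i, (M₁ n *ᵥ y) i ≤ 0 := by
  simp only [M₁_mulVec, sub_nonpos]
  cases n with
  | zero => exact ⟨fun _ i => i.elim0, fun _ i => i.elim0⟩
  | succ n => exact Fin.antitone_iff_succ_le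

variable {lam : ℝ} {t : CutVector K n} {y : Fin n → ℝ}

/-- The mean over a cluster of the shifted sequence. -/
def shiftedMean (lam : ℝ) (t : CutVector K n) (y : Fin n → ℝ) (k : Fin K) : ℝ :=
  (∑ j ∈ Finset.Ico (left t k) (right t k), shifted lam y j) / size t k

lemma shiftedMean_eq (lam : ℝ) (t : CutVector K n) (y : Fin n → ℝ) (k : Fin K) :
    shiftedMean lam t y k =
      (∑ j ∈ Finset.Ico (left t k) (right t k), extend y j) / size t k +
        lam * ((left t k : ℝ) + right t k - n) := by
  have h := size_cast_pos t k
  rw [shiftedMean, sum_shifted lam y (left_lt_right t k).le, ← size_cast]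
  field_simp

lemma right_cur (t : CutVector K n) (k : Fin (K - 1)) : right t (cur k) = left t (next k) := rfl

lemma M₂_lt_iff (k : Fin (K - 1)) :
    (M₂ t *ᵥ y) k < lam * m₂ t k ↔
      shiftedMean lam t y (next k) < shiftedMean lam t y (cur k) := by
  rw [M₂_mulVec, shiftedMean_eq, shiftedMean_eq, m₂, right_cur]
  constructor <;> intro h <;> linarith

lemma M₃_le_iff (r : Σ k : Fin K, Fin (size t k - 1)) :
    (M₃ t *ᵥ y) r ≤ lam * m₃ t r ↔
      ∑ j ∈ Finset.Ico (left t r.1) (left t r.1 + (r.2 + 1)), shifted lam y j ≤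
        ((r.2 : ℝ) + 1) * shiftedMean lam t y r.1 := by
  have hp : (0 : ℝ) < (r.2 : ℝ) + 1 := by positivity
  rw [M₃_mulVec, shiftedMean_eq, m₃, sum_shifted lam y (Nat.le_add_right _ _), size_cast,
    ← mul_le_mul_iff_right₀ hp, mul_sub, mul_div_cancel₀ _ hp.ne']
  push_cast
  constructor <;> intro h <;> linarith

lemma strictAnti_iff_next (b : Fin K → ℝ) :
    StrictAnti b ↔ ∀ k : Fin (K - 1), b (next k) < b (cur k) := by
  cases K with
  | zero => exact ⟨fun _ i => i.elim0, fun _ i => i.elim0⟩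
  | succ n => exact Fin.strictAnti_iff_succ_lt

/-- Strictness is needed only for `M₂`: equal slopes would make a cut spurious, whereas partial sums
may touch a chord. -/
lemma isMajorant_shiftedMean (h2 : ∀ k, (M₂ t *ᵥ y) k < lam * m₂ t k)
    (h3 : ∀ r, (M₃ t *ᵥ y) r ≤ lam * m₃ t r) :
    IsMajorant (shifted lam y) t (shiftedMean lam t y) where
  strictAnti := (strictAnti_iff_next _).2 fun k => M₂_lt_iff k |>.1 (h2 k)
  sum_eq k := (mul_div_cancel₀ _ (size_cast_pos t k).ne').symm
  sum_le k m h1 h2 := by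
    -- `M₃` has no rows for the two ends of a cluster, where equality is automatic.
    rcases h1.eq_or_lt with rfl | h1
    · simp
    rcases h2.eq_or_lt with rfl | h2
    · rw [← size_cast]
      exact (mul_div_cancel₀ _ (size_cast_pos t k).ne').ge
    obtain ⟨l, rfl⟩ := Nat.exists_eq_add_of_lt h1
    have := (M₃_le_iff ⟨k, ⟨l, by unfold size; omega⟩⟩).1 (h3 _)
    simpa [add_assoc] using this

lemma IsMajorant.eq_shiftedMean {b : Fin K → ℝ} (h : IsMajorant (shifted lam y) t b) :
    b = shiftedMean lam t y := by
  ext k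
  rw [shiftedMean, h.sum_eq, mul_div_cancel_left₀ _ (size_cast_pos t k).ne']

lemma IsMajorant.mem_polyhedron {p : CutOrder n} {x : Fin n → ℝ} (hx : Antitone (x ∘ p.2))
    {b : Fin p.1.1 → ℝ} (h : IsMajorant (shifted lam (x ∘ p.2)) p.1.2 b) :
    x ∈ polyhedron lam p := by
  obtain rfl := h.eq_shiftedMean
  refine (mem_polyhedron_iff_blocks p x).2 ⟨(antitone_iff_M₁ _).1 hx, fun k => ?_, fun r => ?_⟩
  · exact ((M₂_lt_iff k).2 ((strictAnti_iff_next _).1 h.strictAnti k)).le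
  · refine (M₃_le_iff r).2 ?_
    have hlt : left p.1.2 r.1 + (r.2 + 1) < right p.1.2 r.1 := by
      have := r.2.2; unfold size at this; omega
    simpa using h.sum_le r.1 _ (Nat.le_add_right _ _) hlt.le

end Rows

/-! ### Optimality conditions for convex clustering -/

section Optimality

variable {K n : ℕ} {lam : ℝ}

/-- The sum over all pairs, unlike the sum over `i < j`, is visibly invariant under relabelling. -/
lemma two_mul_sum_Ioi (g : Fin n → Fin n → ℝ) (hs : ∀ i j, g i j = g j i) (h0 : ∀ i, g i i = 0) :
    2 * ∑ i, ∑ j ∈ Finset.Ioi i, g j i = ∑ i, ∑ j, g j i := by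
  have h := Finset.sum_sum_Ioi_add_eq_sum_sum_off_diag g
  rw [Finset.sum_congr rfl fun i _ => Finset.sum_congr rfl fun j _ =>
    show g j i + g i j = 2 * g j i by rw [hs i j]; ring] at h
  simp only [← Finset.mul_sum] at h
  rw [h]
  refine Finset.sum_congr rfl fun i _ => ?_
  rw [← Finset.sum_compl_add_sum {i}]
  simp [h0]

/-- The criterion is invariant under permutations. -/
lemma objective_comp_perm (σ : Equiv.Perm (Fin n)) (x B : Fin n → ℝ) :
    objective lam (x ∘ σ) (B ∘ σ) = objective lam x B := by
  have key : ∀ B : Fin n → ℝ, 2 * ∑ i, ∑ i' ∈ Finset.Ioi i, |B i' - B i| =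
      ∑ i, ∑ i', |B i' - B i| := fun B =>
    two_mul_sum_Ioi (fun i' i => |B i' - B i|) (fun i j => abs_sub_comm _ _) (by simp)
  have h : ∑ i, ∑ i', |(B ∘ σ) i' - (B ∘ σ) i| = ∑ i, ∑ i', |B i' - B i| := by
    rw [← Equiv.sum_comp σ (fun i => ∑ i', |B i' - B i|)]
    exact Finset.sum_congr rfl fun i _ => Equiv.sum_comp σ (fun i' => |B i' - B (σ i)|)
  rw [← key, ← key] at h
  rw [objective, objective, mul_left_cancel₀ two_ne_zero h]
  congr 2
  exact Equiv.sum_comp σ (fun i => (B i - x i) ^ 2)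

/-- On nonincreasing vectors, the fusion penalty is linear. -/
lemma sum_abs_sub_of_antitone {B : Fin n → ℝ} (hB : Antitone B) :
    ∑ i, ∑ i' ∈ Finset.Ioi i, |B i' - B i| = ∑ i : Fin n, ((n : ℝ) - 1 - 2 * (i : ℝ)) * B i := by
  have h1 : ∑ i, ∑ i' ∈ Finset.Ioi i, |B i' - B i| =
      ∑ i, ∑ i' ∈ Finset.Ioi i, B i - ∑ i, ∑ i' ∈ Finset.Ioi i, B i' := by
    rw [← Finset.sum_sub_distrib]
    refine Finset.sum_congr rfl fun i _ => ?_
    rw [← Finset.sum_sub_distrib]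
    refine Finset.sum_congr rfl fun i' hi' => ?_
    rw [abs_of_nonpos (sub_nonpos.2 (hB (Finset.mem_Ioi.1 hi').le)), neg_sub]
  -- `B i` counts positively for the `n - 1 - i` later indices and negatively for the `i` earlier
  -- ones.
  have h2 : ∑ i, ∑ i' ∈ Finset.Ioi i, B i' = ∑ i' : Fin n, ∑ i ∈ Finset.Iio i', B i' :=
    Finset.sum_comm' (by simp)
  rw [h1, h2, ← Finset.sum_sub_distrib]
  refine Finset.sum_congr rfl fun i _ => ?_
  have hi : ((n - 1 - i : ℕ) : ℝ) = (n : ℝ) - 1 - i := by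
    have := i.2
    rw [Nat.sub_sub, Nat.cast_sub (by omega)]
    push_cast; ring
  simp only [Finset.sum_const, Fin.card_Ioi, Fin.card_Iio, nsmul_eq_mul, hi]
  ring

/-- First-order optimality in the directions that preserve the ordering. -/
lemma sum_sub_shifted_mul_nonneg {y β : Fin n → ℝ} (hmin : IsMinOn (objective lam y) Set.univ β)
    (hβ : Antitone β) {d : Fin n → ℝ} (hd : ∀ i j, i ≤ j → β i = β j → d j ≤ d i) :
    0 ≤ ∑ j, (β j - shifted lam y j) * d j := by
  -- Strict gaps of `β` survive small steps, and `d` breaks ties only in the decreasing direction.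
  have hanti : ∀ᶠ ε : ℝ in nhdsWithin 0 (Set.Ioi 0), Antitone (β + ε • d) := by
    have : ∀ᶠ ε : ℝ in nhdsWithin 0 (Set.Ioi 0), ∀ i j, i ≤ j →
        (β + ε • d) j ≤ (β + ε • d) i := by
      refine Filter.eventually_all.2 fun i => Filter.eventually_all.2 fun j => ?_
      by_cases hij : i ≤ j
      · rcases (hβ hij).eq_or_lt with heq | hlt
        · filter_upwards [self_mem_nhdsWithin] with ε hε _
          have := mul_le_mul_of_nonneg_left (hd i j hij heq.symm) (Set.mem_Ioi.1 hε).le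
          simp only [Pi.add_apply, Pi.smul_apply, smul_eq_mul]
          linarith
        · have hc : Continuous fun ε : ℝ => (β + ε • d) i - (β + ε • d) j := by
            simp only [Pi.add_apply, Pi.smul_apply, smul_eq_mul]; fun_prop
          have : ∀ᶠ ε : ℝ in nhds 0, 0 < (β + ε • d) i - (β + ε • d) j :=
            (hc.tendsto 0).eventually (lt_mem_nhds (by simpa using hlt))
          filter_upwards [nhdsWithin_le_nhds this] with ε hε _
          linarith
      · exact Filter.Eventually.of_forall fun _ h => absurd h hij
    exact this.mono fun ε h i j hij => h i j hij
  -- As the penalty is linear here, the criterion is exactly quadratic in `ε`, with gradient `β -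
  -- shifted`.
  have hexp : ∀ ε : ℝ, Antitone (β + ε • d) →
      objective lam y (β + ε • d) = objective lam y β +
        ε * (∑ j, (β j - shifted lam y j) * d j + ε * ((1 / 2) * ∑ j, d j ^ 2)) := by
    intro ε hε
    simp only [objective, sum_abs_sub_of_antitone hε, sum_abs_sub_of_antitone hβ,
      Finset.mul_sum, ← Finset.sum_add_distrib]
    refine Finset.sum_congr rfl fun j _ => ?_
    simp only [shifted, extend_coe, Pi.add_apply, Pi.smul_apply, smul_eq_mul]
    ring
  have hlim : Filter.Tendsto (fun ε : ℝ => ∑ j, (β j - shifted lam y j) * d j +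
      ε * ((1 / 2) * ∑ j, d j ^ 2)) (nhdsWithin 0 (Set.Ioi 0))
      (nhds (∑ j, (β j - shifted lam y j) * d j)) := by
    have hc : Continuous fun ε : ℝ => ∑ j, (β j - shifted lam y j) * d j +
      ε * ((1 / 2) * ∑ j, d j ^ 2) := by fun_prop
    simpa using (hc.tendsto 0).mono_left nhdsWithin_le_nhds
  refine ge_of_tendsto hlim ?_
  filter_upwards [hanti, self_mem_nhdsWithin] with ε hε hpos
  have h := isMinOn_univ_iff.1 hmin (β + ε • d)
  rw [hexp ε hε] at h
  exact nonneg_of_mul_nonneg_right (by linarith) (Set.mem_Ioi.1 hpos)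

/-- The clusters of the minimizer of the criterion are given by the least concave majorant of the
partial sums of the shifted observations. -/
lemma isMajorant_of_isMinOn {y β : Fin n → ℝ} (hmin : IsMinOn (objective lam y) Set.univ β)
    {t : CutVector K n} {b : Fin K → ℝ} (hb : StrictAnti b)
    (hβ : ∀ (j : Fin n) k, InCluster t k j ↔ β j = b k) :
    IsMajorant (shifted lam y) t b := by
  have hanti : Antitone β := by
    intro i j hij
    obtain ⟨k, h1, h2⟩ := exists_cluster t i.2
    obtain ⟨k', h3, h4⟩ := exists_cluster t j.2
    rw [(hβ i k).1 ⟨h1, h2⟩, (hβ j k').1 ⟨h3, h4⟩]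
    refine hb.antitone (not_lt.1 fun h => ?_)
    have := right_le_left t h
    have : (i : ℕ) ≤ j := hij
    omega
  have hsum : ∀ k m, left t k ≤ m → m ≤ right t k →
      ∑ j : Fin n, (β j - shifted lam y j) * (if left t k ≤ (j : ℕ) ∧ (j : ℕ) < m then 1 else 0) =
        ((m : ℝ) - left t k) * b k - ∑ j ∈ Finset.Ico (left t k) m, shifted lam y j := by
    intro k m h1 h2
    have hc : ∀ j : Fin n,
        (β j - shifted lam y j) * (if left t k ≤ (j : ℕ) ∧ (j : ℕ) < m then 1 else 0) =
        if left t k ≤ (j : ℕ) ∧ (j : ℕ) < m then b k - shifted lam y j else 0 := by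
      intro j
      split_ifs with h
      · rw [mul_one, (hβ j k).1 ⟨h.1, h.2.trans_le h2⟩]
      · rw [mul_zero]
    rw [Finset.sum_congr rfl fun j _ => hc j,
      sum_Ico_eq (fun j => b k - shifted lam y j) (h2.trans (right_le t k)),
      Finset.sum_sub_distrib]
    simp [Nat.cast_sub h1]
  have hle : ∀ k m, left t k ≤ m → m ≤ right t k →
      ∑ j ∈ Finset.Ico (left t k) m, shifted lam y j ≤ ((m : ℝ) - left t k) * b k := by
    intro k m h1 h2
    -- Raising an initial segment of a cluster preserves the ordering.
    have h := sum_sub_shifted_mul_nonneg hmin hanti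
      (d := fun j => if left t k ≤ (j : ℕ) ∧ (j : ℕ) < m then 1 else 0) fun i j hij he => by
        split_ifs with hj hi
        · exact le_rfl
        · have hjk : InCluster t k j := ⟨hj.1, hj.2.trans_le h2⟩
          have hik := (hβ i k).2 (he.trans ((hβ j k).1 hjk))
          exact absurd ⟨hik.1, lt_of_le_of_lt hij hj.2⟩ hi
        · exact zero_le_one
        · exact le_rfl
    rw [hsum k m h1 h2] at h
    linarith
  refine ⟨hb, fun k => le_antisymm ?_ ?_, hle⟩
  · rw [size_cast]
    exact hle k _ (left_lt_right t k).le le_rfl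
  -- A whole cluster may also be lowered, which gives the reverse inequality.
  · have h := sum_sub_shifted_mul_nonneg hmin hanti
      (d := fun j => -(if left t k ≤ (j : ℕ) ∧ (j : ℕ) < right t k then 1 else 0))
      fun i j hij he => by
        have : InCluster t k i ↔ InCluster t k j := by rw [hβ, hβ, he]
        simp only [InCluster] at this
        simp [this]
    simp only [mul_neg, Finset.sum_neg_distrib] at h
    rw [hsum k _ (left_lt_right t k).le le_rfl, ← size_cast] at h
    linarith

/-- The clusters of a clustering are the level sets, in decreasing order of the levels. -/
lemma exists_levels {p : CutOrder n} {B : Fin n → ℝ}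
    (h : clusteringOfCuts p = clusteringOf B) :
    ∃ b : Fin p.1.1 → ℝ, StrictAnti b ∧
      ∀ (j : Fin n) k, InCluster p.1.2 k j ↔ B (p.2 j) = b k := by
  set L := (Finset.univ.image B).sort (· ≥ ·) with hL
  have hlen : p.1.1 = L.length := by
    have := congrArg List.length h
    simpa [clusteringOfCuts, clusteringOf, hL] using this
  have hsort : L.SortedGT := Finset.sortedGT_sort _
  refine ⟨fun k => L[(k : ℕ)]'(hlen ▸ k.2), fun k k' hk => ?_, fun j k => ?_⟩
  · exact hsort.strictAnti_get (a := ⟨k, hlen ▸ k.2⟩) (b := ⟨k', hlen ▸ k'.2⟩) hk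
  · have hk : (k : ℕ) < (clusteringOfCuts p).length := by simp [clusteringOfCuts]
    have h' := List.getElem_of_eq h hk
    simp only [clusteringOfCuts, clusteringOf, List.getElem_ofFn, List.getElem_map] at h'
    have := Finset.ext_iff.1 h' (p.2 j)
    simpa using this

/-- If the clustering of `x` is given by the cuts `t` and the permutation `σ`, then the cuts are
given by a least concave majorant. -/
lemma exists_isMajorant {p : CutOrder n} {x B : Fin n → ℝ}
    (hmin : IsMinOn (objective lam x) Set.univ B) (h : clusteringOfCuts p = clusteringOf B) :
    ∃ b, IsMajorant (shifted lam (x ∘ p.2)) p.1.2 b := by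
  obtain ⟨b, hb, hβ⟩ := exists_levels h
  refine ⟨b, isMajorant_of_isMinOn (β := B ∘ p.2) (isMinOn_univ_iff.2 fun C => ?_) hb hβ⟩
  have hC : C = (C ∘ p.2.symm) ∘ p.2 := by ext; simp
  rw [hC, objective_comp_perm, objective_comp_perm]
  exact isMinOn_univ_iff.1 hmin _

end Optimality

/-! ### The selection event -/

section Selection

variable {n : ℕ} {lam : ℝ}

instance (K : ℕ) : Countable (CutVector K n) := Subtype.countable

instance : Countable (CutOrder n) := by
  unfold CutOrder; infer_instance

/-- Vectors without ties and without equality in the constraints between consecutive clusters. -/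
def IsGeneric (lam : ℝ) (x : Fin n → ℝ) : Prop :=
  Function.Injective x ∧ ∀ (p : CutOrder n) k,
    (constraintMatrix p *ᵥ x) (Sum.inr (Sum.inl k)) ≠ lam * m₂ p.1.2 k

/-- Up to a null set, the polyhedron of `p` is the set of observations with clustering and ordering
given by `p`. -/
lemma IsGeneric.selection_eq_iff {x B : Fin n → ℝ} (hx : IsGeneric lam x)
    (hmin : IsMinOn (objective lam x) Set.univ B) {q : CutOrder n}
    (hS : Antitone fun i => x (q.2 i)) (hT : clusteringOfCuts q = clusteringOf B)
    (p : CutOrder n) : q = p ↔ x ∈ polyhedron lam p := by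
  obtain ⟨b, hb⟩ := exists_isMajorant hmin hT
  refine ⟨fun h => h ▸ hb.mem_polyhedron hS, fun h => ?_⟩
  obtain ⟨h1, h2, h3⟩ := (mem_polyhedron_iff_blocks p x).1 h
  have hS' : Antitone (x ∘ p.2) := (antitone_iff_M₁ _).2 h1
  have hperm : q.2 = p.2 := by
    -- Without ties the decreasing rearrangement is strict, so its range determines it and then the
    -- permutation.
    have ha := hS.strictAnti_of_injective (hx.1.comp q.2.injective)
    have ha' := hS'.strictAnti_of_injective (hx.1.comp p.2.injective)
    have hr : Set.range (fun i => x (q.2 i)) = Set.range (x ∘ p.2) :=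
      (q.2.surjective.range_comp x).trans (p.2.surjective.range_comp x).symm
    have := (ha.range_inj ha').1 hr
    exact Equiv.ext fun i => hx.1 (congrFun this i)
  have hlt : ∀ k, (M₂ p.1.2 *ᵥ (x ∘ p.2)) k < lam * m₂ p.1.2 k := fun k =>
    lt_of_le_of_ne (h2 k) fun he => hx.2 p k (by rw [constraintMatrix_mulVec]; exact he)
  have hcut := hb.cut_unique (hperm ▸ isMajorant_shiftedMean hlt h3)
  exact Prod.ext hcut hperm

variable {Ω : Type*} [MeasurableSpace Ω] {P : Measure Ω} {μ : Fin n → ℝ}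
  {cov : Matrix (Fin n) (Fin n) ℝ} {X : Ω → Fin n → ℝ}

/-- Equality in such a row then defines a genuine hyperplane. The witness is the first position of
the cluster, where the entry is `-1 / size`. -/
lemma constraintMatrix_row_ne_zero (p : CutOrder n) (k : Fin (p.1.1 - 1)) :
    constraintMatrix p (Sum.inr (Sum.inl k)) ≠ 0 := by
  intro h
  have hlt := left_lt_right p.1.2 (cur k)
  let j : Fin n := ⟨left p.1.2 (cur k), hlt.trans_le (right_le _ _)⟩
  have h0 : (constraintMatrix p *ᵥ (Pi.single j (1 : ℝ) ∘ p.2.symm)) (Sum.inr (Sum.inl k)) = 0 := by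
    rw [mulVec, h, zero_dotProduct]
  rw [constraintMatrix_mulVec, Function.comp_assoc, Equiv.symm_comp_self, Function.comp_id,
    mulVec_single_one] at h0
  have h1 : M₂ p.1.2 k j = 0 := h0
  have hj : InCluster p.1.2 (cur k) j := ⟨le_rfl, hlt⟩
  rw [M₂, of_apply, if_pos hj, neg_eq_zero] at h1
  exact (one_div_pos.2 (size_cast_pos p.1.2 (cur k))).ne' h1

/-- A nondegenerate Gaussian vector is almost surely generic. -/
lemma ae_isGeneric (hcov : cov.PosSemidef) (hinv : IsUnit cov)
    (hX : HasLaw (fun ω => WithLp.toLp 2 (X ω)) (multivariateGaussian (WithLp.toLp 2 μ) cov) P) :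
    ∀ᵐ ω ∂P, IsGeneric lam (X ω) := by
  have hne : ∀ {v : Fin n → ℝ}, v ≠ 0 → ∀ r, ∀ᵐ ω ∂P, v ⬝ᵥ X ω ≠ r := fun hv r => by
    rw [ae_iff]
    simpa using measure_dotProduct_eq_zero hcov hinv hX hv r
  have h1 : ∀ᵐ ω ∂P, ∀ i j, i ≠ j → X ω i ≠ X ω j := by
    refine ae_all_iff.2 fun i => ae_all_iff.2 fun j => ?_
    by_cases hij : i = j
    · exact Filter.Eventually.of_forall fun _ h => absurd hij h
    · have hv : (Pi.single i 1 - Pi.single j 1 : Fin n → ℝ) ≠ 0 := fun h => by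
        simpa [hij] using congrFun h i
      filter_upwards [hne hv 0] with ω hω _ he
      exact hω (by simp [sub_dotProduct, he])
  have h2 : ∀ᵐ ω ∂P, ∀ (p : CutOrder n) k,
      (constraintMatrix p *ᵥ X ω) (Sum.inr (Sum.inl k)) ≠ lam * m₂ p.1.2 k :=
    ae_all_iff.2 fun p => ae_all_iff.2 fun k => hne (constraintMatrix_row_ne_zero p k) _
  filter_upwards [h1, h2] with ω h1 h2
  exact ⟨fun i j h => by_contra fun hij => h1 i j hij h, h2⟩

end Selection

/-! ### Mixtures over a countable selection -/

section Mixture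

variable {Ω ι : Type*} [MeasurableSpace Ω] [Countable ι] {P : Measure Ω}

/-- Selecting, among countably many measurable functions, according to a null measurable choice. -/
lemma aemeasurable_select {q : Ω → ι} (hq : ∀ i, NullMeasurableSet {ω | q ω = i} P)
    {g : ι → Ω → ℝ} (hg : ∀ i, AEMeasurable (g i) P) : AEMeasurable (fun ω => g (q ω) ω) P := by
  refine NullMeasurable.aemeasurable fun s hs => ?_
  have : (fun ω => g (q ω) ω) ⁻¹' s = ⋃ i, {ω | q ω = i} ∩ g i ⁻¹' s := by
    ext ω; simp
  rw [this]
  exact NullMeasurableSet.iUnion fun i => (hq i).inter ((hg i).nullMeasurable hs)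

/-- If the selected functions are uniform on each selection event in `D`, then the selected function
is uniform given that the selection lies in `D`. -/
lemma measure_select_le {q : Ω → ι} (hq : ∀ i, NullMeasurableSet {ω | q ω = i} P)
    {g : ι → Ω → ℝ} (hg : ∀ i, AEMeasurable (g i) P) {D : Set ι} {s : ℝ}
    (h : ∀ i ∈ D, P {ω | q ω = i ∧ g i ω ≤ s} = ENNReal.ofReal s * P {ω | q ω = i}) :
    P ({ω | g (q ω) ω ≤ s} ∩ {ω | q ω ∈ D}) = ENNReal.ofReal s * P {ω | q ω ∈ D} := by
  have e1 : {ω | g (q ω) ω ≤ s} ∩ {ω | q ω ∈ D} = ⋃ i : D, {ω | q ω = i ∧ g i ω ≤ s} := by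
    ext ω
    simp only [Set.mem_inter_iff, Set.mem_ofPred_eq, Set.mem_iUnion, Subtype.exists]
    constructor
    · rintro ⟨h1, h2⟩
      exact ⟨q ω, h2, rfl, h1⟩
    · rintro ⟨i, hi, rfl, h1⟩
      exact ⟨h1, hi⟩
  have e2 : {ω | q ω ∈ D} = ⋃ i : D, {ω | q ω = i} := by
    ext ω; simp
  have hd : ∀ f : ι → Set Ω, (∀ i, f i ⊆ {ω | q ω = i}) →
      Pairwise (Function.onFun (AEDisjoint P) fun i : D => f i) := by
    intro f hf i j hij
    refine Disjoint.aedisjoint (Set.disjoint_left.2 fun ω h1 h2 => hij (Subtype.ext ?_))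
    exact (hf i h1).symm.trans (hf j h2)
  rw [e1, e2, measure_iUnion₀ (hd (fun i => {ω | q ω = i ∧ g i ω ≤ s}) fun i ω h => h.1) fun i =>
      (hq i).inter (nullMeasurableSet_le (hg i) aemeasurable_const),
    measure_iUnion₀ (hd (fun i => {ω | q ω = i}) fun i => subset_rfl) fun i => hq i,
    ← ENNReal.tsum_mul_left]
  exact tsum_congr fun i => h i i.2

/-- A function with the uniform distribution function given `A` is uniform given `A`. -/
lemma isUniform_cond_of_measure_le [IsProbabilityMeasure P] {g : Ω → ℝ} (hg : AEMeasurable g P)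
    {A : Set Ω} (hA : NullMeasurableSet A P) (hpos : 0 < P A)
    (h : ∀ s ∈ Set.Icc (0 : ℝ) 1, P ({ω | g ω ≤ s} ∩ A) = ENNReal.ofReal s * P A) :
    pdf.IsUniform g (Set.Icc 0 1) (P[|A]) volume ∧
      ∀ s ∈ Set.Icc (0 : ℝ) 1, (P[|A]) {ω | g ω ≤ s} = ENNReal.ofReal s := by
  have hle : ∀ s ∈ Set.Icc (0 : ℝ) 1, (P[|A]) {ω | g ω ≤ s} = ENNReal.ofReal s := by
    intro s hs
    -- Null measurability of `A` suffices here, whatever the sublevel set of `g`.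
    rw [ProbabilityTheory.cond, Measure.smul_apply, Measure.restrict_apply₀' hA, h s hs,
      smul_eq_mul, mul_comm, mul_assoc, ENNReal.mul_inv_cancel hpos.ne' (measure_ne_top _ _),
      mul_one]
  refine ⟨?_, hle⟩
  have hg' : AEMeasurable g (P[|A]) := hg.mono_ac cond_absolutelyContinuous
  have := cond_isProbabilityMeasure hpos.ne'
  have := Measure.isProbabilityMeasure_map hg'
  have hmap : Measure.map g (P[|A]) = volume.restrict (Set.Icc 0 1) :=
    eq_restrict_Icc_of_measure_Iic fun t ht => by
      rw [Measure.map_apply_of_aemeasurable hg' measurableSet_Iic]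
      exact hle t ht
  rw [pdf.IsUniform, hmap, ProbabilityTheory.cond]
  simp

end Mixture

end ConvexClustering

end

theorem mainTheorem4 {n : ℕ} {Ω : Type*} [MeasurableSpace Ω] (P : Measure Ω)
    [IsProbabilityMeasure P]
    -- the Gaussian vector, with mean `μ` and invertible covariance matrix `cov`
    (μ : Fin n → ℝ) (cov : Matrix (Fin n) (Fin n) ℝ) (hcov : cov.PosSemidef) (hinv : IsUnit cov)
    (X : Ω → Fin n → ℝ)
    (hX : HasLaw (fun ω => WithLp.toLp 2 (X ω)) (multivariateGaussian (WithLp.toLp 2 μ) cov) P)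
    -- convex clustering
    (lam : ℝ) (hlam : 0 < lam) (B : (Fin n → ℝ) → Fin n → ℝ)
    (hB : ∀ x, IsMinOn (ConvexClustering.objective lam x) Set.univ (B x))
    -- the ordering and the right-limits of the clusters, as functions of the observations
    (S : (Fin n → ℝ) → Equiv.Perm (Fin n)) (hS : ∀ x : Fin n → ℝ, Antitone fun i => x (S x i))
    (T : (Fin n → ℝ) → Σ K : ℕ, ConvexClustering.CutVector K n)
    (hT : ∀ x, ConvexClustering.clusteringOfCuts (T x, S x) =
      ConvexClustering.clusteringOf (B x))
    -- the admissible pairs and the tested linear form; only its values on `E` matter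
    (E : Set (ConvexClustering.CutOrder n)) (η : ConvexClustering.CutOrder n → Fin n → ℝ)
    (hη : ∀ p ∈ E, η p ≠ 0)
    (hpos : 0 < P {ω | (T (X ω), S (X ω)) ∈ E ∧ η (T (X ω), S (X ω)) ⬝ᵥ μ = 0}) :
    pdf.IsUniform
        (fun ω => ConvexClustering.pval lam cov (η (T (X ω), S (X ω))) (X ω) (T (X ω), S (X ω)))
        (Set.Icc 0 1)
        (P[|{ω | (T (X ω), S (X ω)) ∈ E ∧ η (T (X ω), S (X ω)) ⬝ᵥ μ = 0}]) volume ∧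
      ∀ t ∈ Set.Icc (0 : ℝ) 1,
        (P[|{ω | (T (X ω), S (X ω)) ∈ E ∧ η (T (X ω), S (X ω)) ⬝ᵥ μ = 0}])
          {ω | ConvexClustering.pval lam cov (η (T (X ω), S (X ω))) (X ω)
            (T (X ω), S (X ω)) ≤ t} = ENNReal.ofReal t := by
  have hXm := ConvexClustering.aemeasurable_of_hasLaw hX
  set q : Ω → ConvexClustering.CutOrder n := fun ω => (T (X ω), S (X ω)) with hqdef
  have hsel : ∀ᵐ ω ∂P, ∀ p, q ω = p ↔ X ω ∈ ConvexClustering.polyhedron lam p := by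
    filter_upwards [ConvexClustering.ae_isGeneric (lam := lam) hcov hinv hX] with ω hω
    exact hω.selection_eq_iff (hB _) (hS _) (hT _)
  have hset : ∀ p, {ω | q ω = p} =ᵐ[P] {ω | X ω ∈ ConvexClustering.polyhedron lam p} := fun p =>
    Filter.eventuallyEq_set.2 (hsel.mono fun ω h => h p)
  -- `S` and `T` are arbitrary functions; their level sets are null measurable because they agree
  -- almost everywhere with polyhedral events.
  have hq : ∀ p, NullMeasurableSet {ω | q ω = p} P := fun p =>
    (hXm.nullMeasurable (ConvexClustering.measurableSet_polyhedron p)).congr (hset p).symm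
  have hg : ∀ p, AEMeasurable (fun ω => ConvexClustering.pval lam cov (η p) (X ω) p) P := fun p =>
    (ConvexClustering.measurable_pval (η p) p).comp_aemeasurable hXm
  have hA : NullMeasurableSet {ω | q ω ∈ {p | p ∈ E ∧ η p ⬝ᵥ μ = 0}} P := by
    have : {ω | q ω ∈ {p | p ∈ E ∧ η p ⬝ᵥ μ = 0}} =
        ⋃ p : {p | p ∈ E ∧ η p ⬝ᵥ μ = 0}, {ω | q ω = p} := by
      ext ω; simp
    rw [this]
    exact NullMeasurableSet.iUnion fun p => hq p
  refine ConvexClustering.isUniform_cond_of_measure_le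
    (ConvexClustering.aemeasurable_select hq hg) hA hpos fun s hs =>
    ConvexClustering.measure_select_le hq hg (D := {p | p ∈ E ∧ η p ⬝ᵥ μ = 0}) fun p hp => ?_
  -- For a fixed `p` the form `η p` is deterministic, so the fixed-polyhedron result applies.
  rw [measure_congr (hset p), ← ConvexClustering.measure_polyhedron_inter_pval_le hcov hinv hX p
    (hη p hp.1) hp.2 hs]
  refine measure_congr (Filter.eventuallyEq_set.2 (hsel.mono fun ω h => ?_))
  exact and_congr_left fun _ => h p
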